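/- Let $0<\alpha\le 1$, $p\in\{1,\dots,6\}$, $q\in\{1,2\}$, $\tau>0$, and $\lambda,\rho,\kappa\in\mathbb C$ with $\lambda+\rho\neq 0$. Let $\omega(z)=\omega(p,\alpha,1,z)$ be one of the two generating functions (principal powers) $$\omega(z)=\Big(\sum_{k=1}^p\tfrac1k(1-z)^k\Big)^{\alpha}\qquad\text{or}\qquad \omega(z)=(1-z)^\alpha\sum_{k=1}^p g^{(\alpha)}_{k-1}(1-z)^{k-1},$$ where $$g^{(\alpha)}_0=1,\quad g^{(\alpha)}_1=\tfrac{\alpha}{2},\quad g^{(\alpha)}_2=\tfrac{\alpha^2}{8}+\tfrac{5\alpha}{24},\quad g^{(\alpha)}_3=\tfrac{\alpha^3}{48}+\tfrac{5\alpha^2}{48}+\tfrac{\alpha}{8},$$ $$g^{(\alpha)}_4=\tfrac{\alpha^4}{384}+\tfrac{5\alpha^3}{192}+\tfrac{97\alpha^2}{1152}+\tfrac{251\alpha}{2880},\quad g^{(\alpha)}_5=\tfrac{\alpha^5}{3840}+\tfrac{5\alpha^4}{1152}+\tfrac{61\alpha^3}{2304}+\tfrac{401\alpha^2}{5760}+\tfrac{19\alpha}{288},$$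 and let $\omega^{(\alpha)}_n$ be its Taylor coefficients at $0$, $\omega(z)=\sum_{n\ge0}\omega^{(\alpha)}_nz^n$. Put $E^n_1(u)=u_n-u_{n-1}$ and $E^n_2(u)=u_n-2u_{n-1}+u_{n-2}$. Let $m,m_u,m_f\ge 0$ be integers, let $0<\sigma_1<\dots<\sigma_{\max(m,m_u)}$ and $0<\delta_1<\dots<\delta_{m_f}$ be real numbers, and put $N=\max\{q,\;\max\{m,m_u,m_f\}+1\}$. For $n\ge N$ let the starting weights $w^{(\alpha)}_{n,j}$ $(1\le j\le m)$, $w^{(u)}_{n,j}$ $(1\le j\le m_u)$, $w^{(f)}_{n,j}$ $(1\le j\le m_f)$ be determined by $$\sum_{j=0}^n\omega^{(\alpha)}_{n-j}j^{\sigma_r}+\sum_{j=1}^m w^{(\alpha)}_{n,j}j^{\sigma_r}=\frac{\Gamma(\sigma_r+1)}{\Gamma(\sigma_r+1-\alpha)}n^{\sigma_r-\alpha}\quad(1\le r\le m),$$ $$E^n_q\big((j^{\sigma_r})_j\big)=\sum_{j=1}^{m_u}w^{(u)}_{n,j}j^{\sigma_r}\ (1\le r\le m_u),\qquad E^n_q\big((j^{\delta_r})_j\big)=\sum_{j=1}^{m_f}w^{(f)}_{n,j}j^{\delta_r}\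 (1\le r\le m_f).$$ For the model problem ${}_CD^\alpha_{0,t}u=(\lambda+\rho)u$, i.e. $f(u,t)=\rho u$ and $F_n=\rho U_n$, consider the semi-implicit scheme with correction terms, for all $n\ge N$, $$\frac1{\tau^\alpha}\Big[\sum_{j=0}^n\omega^{(\alpha)}_{n-j}(U_j-U_0)+\sum_{j=1}^m w^{(\alpha)}_{n,j}(U_j-U_0)\Big]=\lambda U_n+F_n-\Big[E^n_q(F)-\sum_{j=1}^{m_f}w^{(f)}_{n,j}(F_j-F_0)\Big]-\kappa\Big[E^n_q(U)-\sum_{j=1}^{m_u}w^{(u)}_{n,j}(U_j-U_0)\Big].$$ Assume $\sigma_m<\alpha+p$ (if $m\ge1$), $\sigma_{m_u}<q$ (if $m_u\ge1$), $\delta_{m_f}<q$ (if $m_f\ge1$), and $\tau\in\mathbb S$, where $$\mathbb S=\mathbb C\setminus\Big\{\xi\;:\;\xi^\alpha=\frac{\omega(z)}{(\lambda+\rho)-(\rho+\kappa)(1-z)^q}\ \text{for some } |z|\le1\Big\}.$$ Then the scheme is stable: for all starting values $U_0,\dots,U_{N-1}\in\mathbb C$ there is exactly one sequence $(U_n)_{n\ge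 0}$ with these starting values that satisfies the scheme for all $n\ge N$, and $U_n\to0$ as $n\to\infty$. -/

import Mathlib

namespace SemiImplicit

noncomputable section

/-- The two families of generating functions: the fractional backward difference formula and the
generalized Newton--Gregory formula. -/
inductive Family where
  | fbdf : Family
  | gngf : Family

/-- The coefficients `g_k` (as functions of `α`) of the generalized Newton--Gregory formula. -/
def gngCoeff (α : ℝ) : ℕ → ℝ
  | 0 => 1
  | 1 => α / 2
  | 2 => α ^ 2 / 8 + 5 * α / 24
  | 3 => α ^ 3 / 48 + 5 * α ^ 2 / 48 + α / 8
  | 4 => α ^ 4 / 384 + 5 * α ^ 3 / 192 + 97 * α ^ 2 / 1152 + 251 * α / 2880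
  | 5 => α ^ 5 / 3840 + 5 * α ^ 4 / 1152 + 61 * α ^ 3 / 2304 + 401 * α ^ 2 / 5760 + 19 * α / 288
  | _ => 0

/-- The generating function `ω(p, α, 1, z)` with unit step size. Powers with exponent `α` are
principal values. -/
def genFun (F : Family) (p : ℕ) (α : ℝ) (z : ℂ) : ℂ :=
  match F with
  | Family.fbdf => (∑ k ∈ Finset.Icc 1 p, (1 / (k : ℂ)) * (1 - z) ^ k) ^ (α : ℂ)
  | Family.gngf =>
      (1 - z) ^ (α : ℂ) * ∑ k ∈ Finset.Icc 1 p, (gngCoeff α (k - 1) : ℂ) * (1 - z) ^ (k - 1)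

/-- The quadrature weights `ω_n^{(α)}`: the Taylor coefficients at `0` of `z ↦ ω(p, α, 1, z)`. -/
def quadWeight (F : Family) (p : ℕ) (α : ℝ) (n : ℕ) : ℂ :=
  iteratedDeriv n (genFun F p α) 0 / (n.factorial : ℂ)

/-- The corrected convolution operator `D_τ^{(α,n,m,σ)} u` with starting weights `w n j`. -/
def fracDiff (F : Family) (p : ℕ) (α τ : ℝ) (m : ℕ) (w : ℕ → ℕ → ℂ) (u : ℕ → ℂ) (n : ℕ) : ℂ :=
  1 / ((τ ^ α : ℝ) : ℂ) * ∑ j ∈ Finset.range (n + 1), quadWeight F p α (n - j) * (u j - u 0)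
    + 1 / ((τ ^ α : ℝ) : ℂ) * ∑ j ∈ Finset.Icc 1 m, w n j * (u j - u 0)

/-- The penalty term `E_q^n(u)`. It is only used for `q = 1, 2` and `n ≥ q`. -/
def penalty (q : ℕ) (u : ℕ → ℂ) (n : ℕ) : ℂ :=
  match q with
  | 1 => u n - u (n - 1)
  | 2 => u n - 2 * u (n - 1) + u (n - 2)
  | _ => 0

/-- The corrected penalty term `E_q^{n,m,σ}(u)` with correction weights `w n j`. -/
def corrPenalty (q m : ℕ) (w : ℕ → ℕ → ℂ) (u : ℕ → ℂ) (n : ℕ) : ℂ :=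
  penalty q u n - ∑ j ∈ Finset.Icc 1 m, w n j * (u j - u 0)

/-- The function `t ↦ t ^ s` sampled at the integers (the step size scales out of the conditions
on the weights). -/
def powSeq (s : ℝ) (j : ℕ) : ℂ := (((j : ℝ) ^ s : ℝ) : ℂ)

/-- From step `N` on, `w` are the starting weights of the convolution quadrature: the corrected
quadrature is exact for `t ^ σ_r`, `1 ≤ r ≤ m`. -/
def IsStartingWeight (F : Family) (p : ℕ) (α : ℝ) (N m : ℕ) (σ : ℕ → ℝ) (w : ℕ → ℕ → ℂ) : Prop :=
  ∀ n ≥ N, ∀ r ∈ Finset.Icc 1 m,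
    ∑ j ∈ Finset.range (n + 1), quadWeight F p α (n - j) * powSeq (σ r) j
        + ∑ j ∈ Finset.Icc 1 m, w n j * powSeq (σ r) j
      = ((Real.Gamma (σ r + 1) / Real.Gamma (σ r + 1 - α) * (n : ℝ) ^ (σ r - α) : ℝ) : ℂ)

/-- From step `N` on, `w` are the correction weights of the penalty term: the corrected penalty
vanishes for `t ^ σ_r`, `1 ≤ r ≤ m`. -/
def IsPenaltyWeight (q N m : ℕ) (σ : ℕ → ℝ) (w : ℕ → ℕ → ℂ) : Prop :=
  ∀ n ≥ N, ∀ r ∈ Finset.Icc 1 m, corrPenalty q m w (powSeq (σ r)) n = 0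

/-- The first step computed by the scheme: `U_0, …, U_{N-1}` are starting values, where `N` exceeds
the indices used by all correction terms and `N ≥ q`. -/
def firstStep (q m mu mf : ℕ) : ℕ := max q (max m (max mu mf) + 1)

/-- `U` satisfies the semi-implicit scheme with correction terms for
`D^α u = lam * u + f(u, t)`, with `t_n = n τ` and `F_n = f(U_n, t_n)`. -/
def IsSchemeSolution (F : Family) (p q : ℕ) (α τ : ℝ) (lam kap : ℂ) (f : ℂ → ℝ → ℂ)
    (m mu mf : ℕ) (w wu wf : ℕ → ℕ → ℂ) (U : ℕ → ℂ) : Prop :=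
  ∀ n ≥ firstStep q m mu mf,
    fracDiff F p α τ m w U n
      = lam * U n + f (U n) (n * τ)
        - corrPenalty q mf wf (fun j => f (U j) (j * τ)) n
        - kap * corrPenalty q mu wu U n

/-- Stability of a method with `N` starting values and set of numerical solutions `Sol`: arbitrary
starting values determine exactly one numerical solution, and it tends to zero. -/
def IsStable (N : ℕ) (Sol : (ℕ → ℂ) → Prop) : Prop :=
  ∀ v : Fin N → ℂ,
    (∃! U : ℕ → ℂ, Sol U ∧ ∀ k : Fin N, U k = v k) ∧
    ∀ U : ℕ → ℂ, Sol U → (∀ k : Fin N, U k = v k) → Filter.Tendsto U Filter.atTop (nhds 0)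

/-- The stability region `𝕊`. -/
def stabilityRegion (F : Family) (p q : ℕ) (α : ℝ) (lam rho kap : ℂ) : Set ℂ :=
  {ξ : ℂ | ∃ z : ℂ, ‖z‖ ≤ 1 ∧
    ξ ^ (α : ℂ) = genFun F p α z / ((lam + rho) - (rho + kap) * (1 - z) ^ q)}ᶜ

end

end SemiImplicit

/-!
Subtracting the corrections, the scheme is a discrete convolution equation `f * U = g` for `n ≥ N`,
where `f` has the generating function (symbol) `ω(z) - τ^α ((λ + ρ) - (ρ + κ) (1 - z)^q)` and where
`g`, for `n ≥ N`, depends on the starting values only (`scheme_step_iff`). Since `f 0 ≠ 0`, the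
equation is solved uniquely step by step. For `U → 0` two things are shown: `f` is invertible as a
convolution operator on null sequences, and `g` is a null sequence.

*Invertibility.* In `u = 1 - z` the generating function is `u ^ α` times a function holomorphic near
the closed unit disc, so its Taylor coefficients are absolutely summable and represent it up to the
boundary (`hasSum_quadWeight`). This rests on the fact that `B_p(u) = ∑_{k ≤ p} u ^ k / k` maps the
upper half of the disc `|1 - u| ≤ 1` into the upper half plane for `p ≤ 6` (`bdfPoly_im_pos`), which
also shows that `ω` vanishes only at `z = 1`: the Newton--Gregory polynomials are combinations of
the `B_p` with nonnegative coefficients (`mul_gngPoly`). By the choice of the stability region the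
symbol has no zero in the closed disc (`tsum_symbolCoeff_ne_zero`), and Gelfand theory in the Banach
algebra generated by the shift on `c₀` inverts it (`tendsto_zero_of_convolution`).

*Decay of the right hand side.* The partial sums of the quadrature weights tend to `ω(1) = 0`. The
correction weights solve linear systems with the fixed generalized Vandermonde matrix `j ^ σ_r`,
which is regular by Rolle's theorem (`expSum_eq_zero`), so it remains to see that the right hand
sides tend to zero. For the penalty terms they are differences of `n ^ σ` with `σ < q`. For the
quadrature they are the errors `c n ^ (σ - α) - ∑ ω_{n-j} j ^ σ` (`tendsto_quadrature_error`). These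
are values of a function of continuous time whose Laplace transform is
`Γ(σ + 1) s ^ (-σ - 1) (ω(e ^ (-s)) - s ^ α)`, up to a modification for `σ ≤ α`. Consistency of
order `p` (`genFun_exp_sub_cpow`) bounds it by `|s| ^ (α + p - σ - 1)` near the origin, which is
integrable since `σ < α + p`; the error is then the Fourier transform of an integrable function on
the imaginary axis and tends to zero by the Riemann--Lebesgue lemma (`tendsto_zero_of_laplace`).
-/

/-! ### Geometry of the generating functions -/

namespace SemiImplicit

/-- The polynomial `∑_{k=1}^p u^k / k` of the backward difference formula of order `p`, in the
variable `u = 1 - z`. -/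
noncomputable def bdfPoly (p : ℕ) (u : ℂ) : ℂ := ∑ k ∈ Finset.Icc 1 p, (1 / (k : ℂ)) * u ^ k

/-- For `p ≤ 6` the polynomial `bdfPoly p` maps the upper half of the disc `‖1 - u‖ ≤ 1` into the
upper half plane. With `u = x + i v` the quotient `im (bdfPoly p u) / v` is a polynomial in `x` and
`V = v ^ 2 ≤ 2 x - x ^ 2`. -/
lemma bdfPoly_im_pos {p : ℕ} (hp : 1 ≤ p ∧ p ≤ 6) {u : ℂ} (hu : ‖1 - u‖ ≤ 1) (him : 0 < u.im) :
    0 < (bdfPoly p u).im := by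
  obtain ⟨x, v⟩ := u
  have hV : v ^ 2 ≤ 2 * x - x ^ 2 := by
    have h1 : ‖(1 : ℂ) - ⟨x, v⟩‖ ^ 2 ≤ 1 := pow_le_one₀ (norm_nonneg _) hu
    rw [← Complex.normSq_eq_norm_sq, Complex.normSq_apply] at h1
    simp at h1
    nlinarith
  simp only at him
  have hx0 : 0 < x := by nlinarith
  have hx2 : x ≤ 2 := by nlinarith
  set V := v ^ 2 with hVdef
  have hV0 : 0 < V := by positivity
  set W := 2 * x - x ^ 2 with hW
  obtain ⟨h1, h6⟩ := hp
  interval_cases p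
  · simpa [bdfPoly] using him
  · have : (bdfPoly 2 ⟨x, v⟩).im = v * (1 + x) := by
      simp [bdfPoly, Finset.sum_Icc_succ_top, pow_succ, ← Complex.ofReal_ofNat]
      ring
    rw [this]; positivity
  · have : (bdfPoly 3 ⟨x, v⟩).im = v * (1 + x + (x ^ 2 - V / 3)) := by
      simp [bdfPoly, Finset.sum_Icc_succ_top, pow_succ, hVdef, ← Complex.ofReal_ofNat]
      ring
    rw [this]; apply mul_pos him; nlinarith
  · have : (bdfPoly 4 ⟨x, v⟩).im = v * (1 + x + (x ^ 2 - V / 3) + (x ^ 3 - x * V)) := by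
      simp [bdfPoly, Finset.sum_Icc_succ_top, pow_succ, hVdef, ← Complex.ofReal_ofNat]
      ring
    rw [this]; apply mul_pos him
    -- The polynomial decreases in `V ≤ W`, also in the cases below, so that its values on the
    -- circle `V = W` bound it from below.
    have : 0 ≤ (W - V) * (1 / 3 + x) := mul_nonneg (by linarith) (by linarith)
    nlinarith [sq_nonneg (x - 1 / 2), mul_pos hx0 hx0, mul_nonneg hx0.le (sq_nonneg (x - 1 / 2))]
  · have : (bdfPoly 5 ⟨x, v⟩).im = v * (1 + x + (x ^ 2 - V / 3) + (x ^ 3 - x * V)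
        + (x ^ 4 - 2 * x ^ 2 * V + V ^ 2 / 5)) := by
      simp [bdfPoly, Finset.sum_Icc_succ_top, pow_succ, hVdef, ← Complex.ofReal_ofNat]
      ring
    rw [this]; apply mul_pos him
    have h2 : 0 ≤ (W - V) * (1 / 3 + x + 2 * x ^ 2 - (V + W) / 5) :=
      mul_nonneg (by linarith) (by nlinarith)
    nlinarith [sq_nonneg (x - 1 / 2), mul_pos hx0 hx0, mul_nonneg hx0.le (sq_nonneg (x - 1 / 2)),
      sq_nonneg (x ^ 2 - 3 / 4 * x), sq_nonneg (x ^ 2 - 3 / 4 * x - 1 / 4), pow_pos hx0 3]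
  · have : (bdfPoly 6 ⟨x, v⟩).im = v * (1 + x + (x ^ 2 - V / 3) + (x ^ 3 - x * V)
        + (x ^ 4 - 2 * x ^ 2 * V + V ^ 2 / 5) + (x ^ 5 - 10 / 3 * x ^ 3 * V + x * V ^ 2)) := by
      simp [bdfPoly, Finset.sum_Icc_succ_top, pow_succ, hVdef, ← Complex.ofReal_ofNat]
      ring
    rw [this]; apply mul_pos him
    have h2 : 0 ≤ (W - V) * (1 / 3 + x + 2 * x ^ 2 + 10 / 3 * x ^ 3 - (V + W) * (1 / 5 + x)) := by
      apply mul_nonneg (by linarith)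
      have : (V + W) * (1 / 5 + x) ≤ (2 * W) * (1 / 5 + x) := by
        apply mul_le_mul_of_nonneg_right <;> linarith
      nlinarith [mul_nonneg hx0.le (sq_nonneg (x - 1 / 4)), mul_pos hx0 hx0]
    -- The values on the circle `V = W`.
    have h3 : 0 < 1 + x + (4 * x ^ 2 - 2 * x) / 3 + (2 * x ^ 3 - 2 * x ^ 2)
        + (16 * x ^ 4 - 24 * x ^ 3 + 4 * x ^ 2) / 5
        + (32 * x ^ 5 - 64 * x ^ 4 + 24 * x ^ 3) / 6 := by
      nlinarith [mul_nonneg hx0.le (sq_nonneg (x ^ 2 - x - 1 / 10)), sq_nonneg (x ^ 2 - x),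
        mul_nonneg hx0.le (sq_nonneg (x - 1)), mul_nonneg hx0.le (sq_nonneg (x ^ 2 - 6 / 5 * x)),
        sq_nonneg (x - 1), sq_nonneg (x ^ 2 - 1), pow_pos hx0 2, pow_pos hx0 3]
    nlinarith

lemma bdfPoly_conj (p : ℕ) (u : ℂ) :
    bdfPoly p (starRingEnd ℂ u) = starRingEnd ℂ (bdfPoly p u) := by
  simp [bdfPoly]

lemma norm_one_sub_conj (u : ℂ) : ‖1 - starRingEnd ℂ u‖ = ‖1 - u‖ := by
  rw [← Complex.norm_conj (1 - u)]; simp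

lemma re_pos_of_norm_one_sub_le {u : ℂ} (hu : ‖1 - u‖ ≤ 1) (h0 : u ≠ 0) : 0 < u.re := by
  have h1 : ‖1 - u‖ ^ 2 ≤ 1 := pow_le_one₀ (norm_nonneg _) hu
  rw [← Complex.normSq_eq_norm_sq, Complex.normSq_apply] at h1
  simp at h1
  by_contra! h
  apply h0
  apply Complex.ext <;> simp <;> nlinarith [sq_nonneg u.re, sq_nonneg u.im]

lemma bdfPoly_ofReal (p : ℕ) (x : ℝ) :
    bdfPoly p x = ((∑ k ∈ Finset.Icc 1 p, (1 / (k : ℝ)) * x ^ k : ℝ) : ℂ) := by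
  simp [bdfPoly]

lemma bdfPoly_real_pos {p : ℕ} (hp : 1 ≤ p) {x : ℝ} (hx : 0 < x) :
    0 < ∑ k ∈ Finset.Icc 1 p, (1 / (k : ℝ)) * x ^ k := by
  apply Finset.sum_pos
  · intro k hk
    have : 0 < k := by simp at hk; omega
    positivity
  · exact ⟨1, by simp; omega⟩

/-- `bdfPoly p u / u`. -/
noncomputable def bdfQuot (p : ℕ) (u : ℂ) : ℂ := ∑ k ∈ Finset.Icc 1 p, (1 / (k : ℂ)) * u ^ (k - 1)

lemma bdfPoly_eq_mul (p : ℕ) (u : ℂ) : bdfPoly p u = u * bdfQuot p u := by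
  rw [bdfPoly, bdfQuot, Finset.mul_sum]
  refine Finset.sum_congr rfl fun k hk => ?_
  obtain ⟨j, rfl⟩ : ∃ j, k = j + 1 := ⟨k - 1, by simp at hk; omega⟩
  simp [pow_succ]; ring

lemma bdfQuot_zero {p : ℕ} (hp : 1 ≤ p) : bdfQuot p 0 = 1 := by
  rw [bdfQuot, Finset.sum_eq_single_of_mem 1 (by simp; omega)]
  · simp
  · intro k hk hk1
    have : k - 1 ≠ 0 := by simp at hk; omega
    simp [this]

lemma bdfPoly_ne_zero {p : ℕ} (hp : 1 ≤ p ∧ p ≤ 6) {u : ℂ} (hu : ‖1 - u‖ ≤ 1) (h0 : u ≠ 0) :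
    bdfPoly p u ≠ 0 := by
  intro h
  rcases lt_trichotomy u.im 0 with hi | hi | hi
  · have := bdfPoly_im_pos hp (u := starRingEnd ℂ u) (by rwa [norm_one_sub_conj]) (by simpa)
    rw [bdfPoly_conj, h] at this
    simp at this
  · have hx := re_pos_of_norm_one_sub_le hu h0
    have hu' : u = (u.re : ℂ) := Complex.ext rfl (by simpa using hi)
    rw [hu', bdfPoly_ofReal] at h
    exact (bdfPoly_real_pos hp.1 hx).ne' (by exact_mod_cast h)
  · have := bdfPoly_im_pos hp hu hi
    rw [h] at this
    simp at this

/-- The argument of `bdfPoly p u` has the sign of the argument of `u`, so that the arguments of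
`bdfPoly p u` and `u` differ by less than `π`. -/
lemma arg_bdfPoly_sub_arg {p : ℕ} (hp : 1 ≤ p ∧ p ≤ 6) {u : ℂ} (hu : ‖1 - u‖ ≤ 1) (h0 : u ≠ 0) :
    (bdfPoly p u).arg - u.arg ∈ Set.Ioo (-Real.pi) Real.pi := by
  have hx := re_pos_of_norm_one_sub_le hu h0
  have ha := abs_lt.1 (Complex.abs_arg_lt_pi_div_two_iff.2 (Or.inl hx))
  have hpi := Real.pi_pos
  rcases lt_trichotomy u.im 0 with hi | hi | hi
  · have hB : (bdfPoly p u).im < 0 := by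
      have := bdfPoly_im_pos hp (u := starRingEnd ℂ u) (by rwa [norm_one_sub_conj]) (by simpa)
      rw [bdfPoly_conj] at this
      simpa using this
    have h1 := Complex.arg_neg_iff.2 hi
    have h2 := Complex.arg_neg_iff.2 hB
    have h3 := Complex.neg_pi_lt_arg (bdfPoly p u)
    constructor <;> linarith
  · have hu' : u = (u.re : ℂ) := Complex.ext rfl (by simpa using hi)
    rw [hu', bdfPoly_ofReal, Complex.arg_ofReal_of_nonneg hx.le,
      Complex.arg_ofReal_of_nonneg (bdfPoly_real_pos hp.1 hx).le]
    constructor <;> linarith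
  · have hB := bdfPoly_im_pos hp hu hi
    have h1 := Complex.arg_nonneg_iff.2 hi.le
    have h2 := Complex.arg_nonneg_iff.2 hB.le
    have h3 : (bdfPoly p u).arg < Real.pi :=
      lt_of_le_of_ne (Complex.arg_le_pi _) fun h => hB.ne' (Complex.arg_eq_pi_iff.1 h).2
    have h4 : u.arg ≠ 0 := fun h => hi.ne' (Complex.arg_eq_zero_iff.1 h).2
    have h5 : 0 < u.arg := lt_of_le_of_ne h1 h4.symm
    constructor <;> linarith

/-- No multiple of `2 π i` occurs here, by the bound on the difference of the arguments. -/
lemma log_bdfQuot {p : ℕ} (hp : 1 ≤ p ∧ p ≤ 6) {u : ℂ} (hu : ‖1 - u‖ ≤ 1) (h0 : u ≠ 0) :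
    Complex.log (bdfQuot p u) = Complex.log (bdfPoly p u) - Complex.log u := by
  have hx := re_pos_of_norm_one_sub_le hu h0
  have ha := abs_lt.1 (Complex.abs_arg_lt_pi_div_two_iff.2 (Or.inl hx))
  have hpi := Real.pi_pos
  have hne : u.arg ≠ Real.pi := by intro h; rw [h] at ha; linarith
  have hB := bdfPoly_ne_zero hp hu h0
  have hd := arg_bdfPoly_sub_arg hp hu h0
  have : bdfQuot p u = bdfPoly p u * u⁻¹ := by rw [bdfPoly_eq_mul]; field_simp
  rw [this, (Complex.log_mul_eq_add_log_iff hB (inv_ne_zero h0)).2, Complex.log_inv _ hne,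
    sub_eq_add_neg]
  rw [Complex.arg_inv, if_neg hne]
  exact ⟨by linarith [hd.1], by linarith [hd.2]⟩

lemma bdfQuot_mem_slitPlane {p : ℕ} (hp : 1 ≤ p ∧ p ≤ 6) {u : ℂ} (hu : ‖1 - u‖ ≤ 1) :
    bdfQuot p u ∈ Complex.slitPlane := by
  by_cases h0 : u = 0
  · rw [h0, bdfQuot_zero hp.1]; exact Complex.one_mem_slitPlane
  rw [Complex.mem_slitPlane_iff_arg]
  constructor
  · intro h
    have h1 := congrArg Complex.im (log_bdfQuot hp hu h0)
    rw [Complex.sub_im, Complex.log_im, Complex.log_im, Complex.log_im, h] at h1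
    exact (arg_bdfPoly_sub_arg hp hu h0).2.ne h1.symm
  · intro h
    apply bdfPoly_ne_zero hp hu h0
    rw [bdfPoly_eq_mul, h, mul_zero]

/-- The principal power of `bdfPoly p u = u * bdfQuot p u` factors on the disc. -/
lemma bdfPoly_cpow {p : ℕ} (hp : 1 ≤ p ∧ p ≤ 6) {a : ℂ} (ha : a ≠ 0) {u : ℂ} (hu : ‖1 - u‖ ≤ 1) :
    bdfPoly p u ^ a = u ^ a * bdfQuot p u ^ a := by
  by_cases h0 : u = 0
  · simp [h0, bdfPoly_eq_mul, ha]
  have hB := bdfPoly_ne_zero hp hu h0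
  have hQ := Complex.slitPlane_ne_zero (bdfQuot_mem_slitPlane hp hu)
  rw [Complex.cpow_def_of_ne_zero hB, Complex.cpow_def_of_ne_zero h0,
    Complex.cpow_def_of_ne_zero hQ, log_bdfQuot hp hu h0, ← Complex.exp_add]
  ring_nf

/-- The polynomial factor of the generalized Newton--Gregory generating function. -/
noncomputable def gngPoly (p : ℕ) (α : ℝ) (u : ℂ) : ℂ :=
  ∑ k ∈ Finset.Icc 1 p, (gngCoeff α (k - 1) : ℂ) * u ^ (k - 1)

lemma gngCoeff_pos {α : ℝ} (h0 : 0 < α) {k : ℕ} (hk : k < 6) : 0 < gngCoeff α k := by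
  interval_cases k <;> simp only [gngCoeff] <;> positivity

/-- The sequence `(k + 1) g_k` decreases, which makes the coefficients in `mul_gngPoly`
nonnegative. -/
lemma gngCoeff_succ_le {α : ℝ} (h0 : 0 < α) (h1 : α ≤ 1) {k : ℕ} (hk : k < 5) :
    ((k : ℝ) + 2) * gngCoeff α (k + 1) ≤ (k + 1) * gngCoeff α k := by
  have h2 : α ^ 2 ≤ α := by nlinarith
  have h3 : α ^ 3 ≤ α ^ 2 := by nlinarith [pow_pos h0 2]
  have h4 : α ^ 4 ≤ α ^ 3 := by nlinarith [pow_pos h0 3]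
  have h5 : α ^ 5 ≤ α ^ 4 := by nlinarith [pow_pos h0 4]
  interval_cases k <;> simp only [gngCoeff] <;> push_cast <;> nlinarith

/-- Summation by parts: the Newton--Gregory polynomial in terms of the polynomials of the backward
difference formulas of lower order. -/
lemma mul_gngPoly (p : ℕ) (α : ℝ) (u : ℂ) :
    u * gngPoly (p + 1) α u =
      ∑ k ∈ Finset.range p, (((k + 1) * gngCoeff α k - (k + 2) * gngCoeff α (k + 1) : ℝ) : ℂ)
        * bdfPoly (k + 1) u + (((p + 1) * gngCoeff α p : ℝ) : ℂ) * bdfPoly (p + 1) u := by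
  induction p with
  | zero => simp [gngPoly, bdfPoly, mul_comm]
  | succ p ih =>
    have e1 : gngPoly (p + 1 + 1) α u = gngPoly (p + 1) α u + gngCoeff α (p + 1) * u ^ (p + 1) := by
      rw [gngPoly, Finset.sum_Icc_succ_top (by omega)]; rfl
    have e2 : bdfPoly (p + 1 + 1) u = bdfPoly (p + 1) u + 1 / ((p : ℂ) + 2) * u ^ (p + 2) := by
      rw [bdfPoly, Finset.sum_Icc_succ_top (by omega)]
      change bdfPoly (p + 1) u + _ = _
      push_cast
      ring
    have h2 : (p : ℂ) + 2 ≠ 0 := by exact_mod_cast (by omega : p + 2 ≠ 0)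
    rw [e1, mul_add, ih, Finset.sum_range_succ, e2]
    push_cast
    field_simp
    ring

lemma mul_gngPoly_im_pos {p : ℕ} (hp : 1 ≤ p ∧ p ≤ 6) {α : ℝ} (hα : 0 < α ∧ α ≤ 1) {u : ℂ}
    (hu : ‖1 - u‖ ≤ 1) (him : 0 < u.im) : 0 < (u * gngPoly p α u).im := by
  obtain ⟨p, rfl⟩ : ∃ j, p = j + 1 := ⟨p - 1, by omega⟩
  rw [mul_gngPoly, Complex.add_im, Complex.im_sum]
  apply add_pos_of_nonneg_of_pos
  · apply Finset.sum_nonneg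
    intro k hk
    rw [Finset.mem_range] at hk
    rw [Complex.im_ofReal_mul]
    have := gngCoeff_succ_le hα.1 hα.2 (k := k) (by omega)
    exact mul_nonneg (by linarith) (bdfPoly_im_pos (by omega) hu him).le
  · rw [Complex.im_ofReal_mul]
    have := gngCoeff_pos hα.1 (k := p) (by omega)
    exact mul_pos (by positivity) (bdfPoly_im_pos hp hu him)

lemma gngPoly_ne_zero {p : ℕ} (hp : 1 ≤ p ∧ p ≤ 6) {α : ℝ} (hα : 0 < α ∧ α ≤ 1) {u : ℂ}
    (hu : ‖1 - u‖ ≤ 1) : gngPoly p α u ≠ 0 := by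
  intro h
  rcases lt_trichotomy u.im 0 with hi | hi | hi
  · have := mul_gngPoly_im_pos hp hα (u := starRingEnd ℂ u) (by rwa [norm_one_sub_conj]) (by simpa)
    rw [show gngPoly p α (starRingEnd ℂ u) = starRingEnd ℂ (gngPoly p α u) by simp [gngPoly],
      h] at this
    simp at this
  · have hx : 0 ≤ u.re := by
      by_cases h0 : u = 0
      · simp [h0]
      · exact (re_pos_of_norm_one_sub_le hu h0).le
    have hu' : u = (u.re : ℂ) := Complex.ext rfl (by simpa using hi)
    have h2 : gngPoly p α u
        = ((∑ k ∈ Finset.Icc 1 p, gngCoeff α (k - 1) * u.re ^ (k - 1) : ℝ) : ℂ) := by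
      rw [hu']; simp [gngPoly]
    have h3 : 0 < ∑ k ∈ Finset.Icc 1 p, gngCoeff α (k - 1) * u.re ^ (k - 1) := by
      apply Finset.sum_pos'
      · intro k hk
        have := gngCoeff_pos hα.1 (k := k - 1) (by simp at hk; omega)
        positivity
      · exact ⟨1, by simp; omega, by simp [gngCoeff]⟩
    rw [h2] at h
    exact h3.ne' (by exact_mod_cast h)
  · have := mul_gngPoly_im_pos hp hα hu hi
    rw [h] at this
    simp at this

/-- The regular factor `h` in the factorization `ω(z) = u ^ α * h(u)`, `u = 1 - z`. -/
noncomputable def regFactor (F : Family) (p : ℕ) (α : ℝ) (u : ℂ) : ℂ :=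
  match F with
  | Family.fbdf => bdfQuot p u ^ (α : ℂ)
  | Family.gngf => gngPoly p α u

lemma genFun_eq {F : Family} {p : ℕ} (hp : 1 ≤ p ∧ p ≤ 6) {α : ℝ} (hα : 0 < α) {z : ℂ}
    (hz : ‖z‖ ≤ 1) : genFun F p α z = (1 - z) ^ (α : ℂ) * regFactor F p α (1 - z) := by
  cases F
  · have := bdfPoly_cpow hp (a := α) (by exact_mod_cast hα.ne') (u := 1 - z) (by simpa using hz)
    simpa [genFun, regFactor, bdfPoly] using this
  · rfl

lemma regFactor_ne_zero {F : Family} {p : ℕ} (hp : 1 ≤ p ∧ p ≤ 6) {α : ℝ} (hα : 0 < α ∧ α ≤ 1)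
    {u : ℂ} (hu : ‖1 - u‖ ≤ 1) : regFactor F p α u ≠ 0 := by
  cases F
  · have hQ := Complex.slitPlane_ne_zero (bdfQuot_mem_slitPlane hp hu)
    simp [regFactor, Complex.cpow_eq_zero_iff, hQ]
  · exact gngPoly_ne_zero hp hα hu

lemma genFun_ne_zero {F : Family} {p : ℕ} (hp : 1 ≤ p ∧ p ≤ 6) {α : ℝ} (hα : 0 < α ∧ α ≤ 1)
    {z : ℂ} (hz : ‖z‖ ≤ 1) (h1 : z ≠ 1) : genFun F p α z ≠ 0 := by
  rw [genFun_eq hp hα.1 hz]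
  refine mul_ne_zero ?_ (regFactor_ne_zero hp hα (by simpa using hz))
  simp [Complex.cpow_eq_zero_iff, sub_ne_zero, h1.symm]

lemma genFun_one {F : Family} {p : ℕ} (hp : 1 ≤ p ∧ p ≤ 6) {α : ℝ} (hα : 0 < α) :
    genFun F p α 1 = 0 := by
  rw [genFun_eq hp hα (by simp)]
  simp [hα.ne']

lemma continuous_bdfQuot (p : ℕ) : Continuous (bdfQuot p) := by
  unfold bdfQuot; fun_prop

lemma differentiable_bdfQuot (p : ℕ) : Differentiable ℂ (bdfQuot p) := by
  unfold bdfQuot; fun_prop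

lemma differentiable_gngPoly (p : ℕ) (α : ℝ) : Differentiable ℂ (gngPoly p α) := by
  unfold gngPoly; fun_prop

lemma differentiableAt_regFactor {F : Family} {p : ℕ} {α : ℝ} {u : ℂ}
    (hQ : bdfQuot p u ∈ Complex.slitPlane) : DifferentiableAt ℂ (regFactor F p α) u := by
  cases F
  · exact ((differentiable_bdfQuot p) u).cpow_const hQ
  · exact differentiable_gngPoly p α u

end SemiImplicit

/-! ### Taylor coefficients of the generating functions -/

namespace SemiImplicit

/-- The `n`-th Taylor coefficient of `f` at `0`. -/
noncomputable def taylorCoeff (f : ℂ → ℂ) (n : ℕ) : ℂ := iteratedDeriv n f 0 / (n.factorial : ℂ)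

lemma hasSum_taylorCoeff {f : ℂ → ℂ} {r : ℝ} (hf : DifferentiableOn ℂ f (Metric.ball 0 r))
    {z : ℂ} (hz : z ∈ Metric.ball 0 r) : HasSum (fun n => taylorCoeff f n * z ^ n) (f z) := by
  refine (Complex.hasSum_taylorSeries_on_ball hf hz).congr_fun fun n => ?_
  simp [taylorCoeff, div_eq_inv_mul]
  ring

lemma taylorCoeff_mul {f g : ℂ → ℂ} (hf : AnalyticAt ℂ f 0) (hg : AnalyticAt ℂ g 0) (n : ℕ) :
    taylorCoeff (f * g) n
      = ∑ kl ∈ Finset.HasAntidiagonal.antidiagonal n, taylorCoeff f kl.1 * taylorCoeff g kl.2 := by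
  rw [taylorCoeff, iteratedDeriv_mul hf.contDiffAt hg.contDiffAt,
    Finset.Nat.sum_antidiagonal_eq_sum_range_succ_mk, Finset.sum_div]
  refine Finset.sum_congr rfl fun k hk => ?_
  have hk : k ≤ n := by simpa [Nat.lt_succ_iff] using hk
  have h1 := Nat.choose_mul_factorial_mul_factorial hk
  have h2 : ((n.choose k : ℂ)) * k.factorial * (n - k).factorial = n.factorial := by
    exact_mod_cast h1
  have h3 : (k.factorial : ℂ) ≠ 0 := by exact_mod_cast k.factorial_ne_zero
  have h4 : ((n - k).factorial : ℂ) ≠ 0 := by exact_mod_cast (n - k).factorial_ne_zero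
  have h5 : (n.factorial : ℂ) ≠ 0 := by exact_mod_cast n.factorial_ne_zero
  simp only [taylorCoeff]
  field_simp
  rw [← h2]
  ring

/-- The coefficients of the binomial series of `(1 - z) ^ α`. -/
noncomputable def binomCoeff (α : ℝ) : ℕ → ℝ
  | 0 => 1
  | n + 1 => (n - α) / (n + 1) * binomCoeff α n

lemma neg_one_pow_mul_choose (α : ℝ) (n : ℕ) :
    (-1) ^ n * Ring.choose (α : ℂ) n = (binomCoeff α n : ℂ) := by
  induction n with
  | zero => simp [binomCoeff]
  | succ n ih =>
    have h5 : (n.factorial : ℂ) ≠ 0 := by exact_mod_cast n.factorial_ne_zero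
    have h6 : ((n : ℂ) + 1) ≠ 0 := by exact_mod_cast n.succ_ne_zero
    rw [binomCoeff]
    push_cast
    rw [← ih, Ring.choose_eq_smul, Ring.choose_eq_smul, descPochhammer_succ_right]
    simp only [Polynomial.smeval_mul, Polynomial.smeval_sub, Polynomial.smeval_X,
      Polynomial.smeval_natCast, Nat.factorial_succ, smul_eq_mul, pow_one, pow_zero, nsmul_eq_mul]
    push_cast
    field_simp
    ring

lemma taylorCoeff_one_sub_cpow (α : ℝ) (n : ℕ) :
    taylorCoeff (fun z => (1 - z) ^ (α : ℂ)) n = (binomCoeff α n : ℂ) := by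
  have h1 := Complex.one_add_cpow_hasFPowerSeriesAt_zero (a := (α : ℂ))
  have h2 := h1.analyticAt.hasFPowerSeriesAt
  have h3 := h1.eq_formalMultilinearSeries h2
  have h4 : iteratedDeriv n (fun z : ℂ => (1 + z) ^ (α : ℂ)) 0 / (n.factorial : ℂ)
      = Ring.choose (α : ℂ) n := by
    rw [binomialSeries, FormalMultilinearSeries.ofScalars_series_eq_iff] at h3
    exact (congrFun h3 n).symm
  have h5 := iteratedDeriv_comp_neg n (fun z : ℂ => (1 + z) ^ (α : ℂ)) 0
  simp only [← sub_eq_add_neg, neg_zero, smul_eq_mul] at h5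
  rw [← neg_one_pow_mul_choose, ← h4, taylorCoeff, h5]
  ring

lemma binomCoeff_succ_nonpos {α : ℝ} (hα : 0 < α ∧ α ≤ 1) (n : ℕ) : binomCoeff α (n + 1) ≤ 0 := by
  induction n with
  | zero => simp [binomCoeff, hα.1.le]
  | succ n ih =>
    rw [binomCoeff]
    apply mul_nonpos_of_nonneg_of_nonpos _ ih
    have : (0 : ℝ) ≤ n := n.cast_nonneg
    apply div_nonneg <;> push_cast <;> linarith [hα.2]

/-- The partial sums of the series of `(1 - z) ^ α` at `z = 1`. -/
lemma sum_binomCoeff {α : ℝ} (hα : 0 < α) (n : ℕ) :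
    ∑ k ∈ Finset.range (n + 1), binomCoeff α k = -((n + 1) * binomCoeff α (n + 1)) / α := by
  induction n with
  | zero => simp [binomCoeff, hα.ne']
  | succ n ih =>
    rw [Finset.sum_range_succ, ih, binomCoeff.eq_2 α (n + 1)]
    have : (n : ℝ) + 1 + 1 ≠ 0 := by positivity
    push_cast
    field_simp
    ring

/-- All coefficients but the first have the same sign and the partial sums are nonnegative, hence
absolute convergence. -/
lemma summable_abs_binomCoeff {α : ℝ} (hα : 0 < α ∧ α ≤ 1) :
    Summable fun n => |binomCoeff α n| := by
  rw [← summable_nat_add_iff 1]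
  refine summable_of_sum_range_le (c := 1) (fun n => abs_nonneg _) fun n => ?_
  have h1 := sum_binomCoeff hα.1 n
  rw [Finset.sum_range_succ'] at h1
  have h2 : 0 ≤ -((n + 1) * binomCoeff α (n + 1)) / α := by
    have := binomCoeff_succ_nonpos hα n
    have h0 : (0 : ℝ) ≤ n + 1 := by positivity
    apply div_nonneg _ hα.1.le
    nlinarith
  have h3 : ∑ i ∈ Finset.range n, |binomCoeff α (i + 1)|
      = -∑ i ∈ Finset.range n, binomCoeff α (i + 1) := by
    rw [← Finset.sum_neg_distrib]
    exact Finset.sum_congr rfl fun i _ => abs_of_nonpos (binomCoeff_succ_nonpos hα i)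
  have h4 : binomCoeff α 0 = 1 := rfl
  rw [h3]
  linarith

/-- Taylor coefficients of a function that is holomorphic on a disc of radius greater than `1` are
absolutely summable. -/
lemma summable_norm_taylorCoeff {f : ℂ → ℂ} {r : ℝ} (hr : 1 < r)
    (hf : DifferentiableOn ℂ f (Metric.ball 0 r)) : Summable fun n => ‖taylorCoeff f n‖ := by
  obtain ⟨s, hs1, hsr⟩ := exists_between hr
  have h := (hasSum_taylorCoeff hf (z := (s : ℂ)) (by simp [abs_of_pos (by linarith : 0 < s), hsr]))
  refine Summable.of_nonneg_of_le (fun _ => norm_nonneg _) (fun n => ?_) h.summable.norm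
  rw [norm_mul, norm_pow]
  refine le_mul_of_one_le_right (norm_nonneg _) (one_le_pow₀ ?_)
  simp only [Complex.norm_real, Real.norm_eq_abs]
  exact hs1.le.trans (le_abs_self s)

lemma exists_differentiableOn_regFactor (F : Family) {p : ℕ} (hp : 1 ≤ p ∧ p ≤ 6) (α : ℝ) :
    ∃ r : ℝ, 1 < r ∧
      DifferentiableOn ℂ (fun z => regFactor F p α (1 - z)) (Metric.ball 0 r) := by
  have hopen : IsOpen {z : ℂ | bdfQuot p (1 - z) ∈ Complex.slitPlane} :=
    Complex.isOpen_slitPlane.preimage ((continuous_bdfQuot p).comp (by fun_prop))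
  obtain ⟨δ, hδ, hsub⟩ := (isCompact_closedBall (0 : ℂ) 1).exists_thickening_subset_open hopen
    (fun z hz => bdfQuot_mem_slitPlane hp (by simpa using hz))
  refine ⟨1 + δ, by linarith, fun z hz => ?_⟩
  rw [thickening_closedBall hδ zero_le_one, add_comm] at hsub
  have := differentiableAt_regFactor (F := F) (α := α) (hsub hz)
  exact (this.comp z (by fun_prop : DifferentiableAt ℂ (fun z : ℂ => 1 - z) z)
    ).differentiableWithinAt

section

variable {F : Family} {p : ℕ} {α : ℝ}

lemma analyticAt_one_sub_cpow (a : ℂ) : AnalyticAt ℂ (fun z : ℂ => (1 - z) ^ a) 0 :=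
  (analyticAt_const.sub analyticAt_id).cpow analyticAt_const (by simp)

lemma summable_norm_quadWeight (hp : 1 ≤ p ∧ p ≤ 6) (hα : 0 < α ∧ α ≤ 1) :
    Summable fun n => ‖quadWeight F p α n‖ := by
  obtain ⟨r, hr, hd⟩ := exists_differentiableOn_regFactor F hp α
  have h1 : Summable fun n => ‖taylorCoeff (fun z => (1 - z) ^ (α : ℂ)) n‖ := by
    simpa [taylorCoeff_one_sub_cpow] using summable_abs_binomCoeff hα
  have h2 := summable_norm_taylorCoeff hr hd
  have h3 := summable_norm_sum_mul_antidiagonal_of_summable_norm h1 h2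
  have hball : Metric.ball (0 : ℂ) 1 ∈ nhds (0 : ℂ) := Metric.ball_mem_nhds _ one_pos
  refine h3.congr fun n => ?_
  rw [← taylorCoeff_mul (analyticAt_one_sub_cpow _)
    (hd.analyticAt (Metric.ball_mem_nhds _ (by linarith)))]
  have : genFun F p α =ᶠ[nhds 0]
      (fun z => (1 - z) ^ (α : ℂ)) * fun z => regFactor F p α (1 - z) := by
    filter_upwards [hball] with z hz
    rw [genFun_eq hp hα.1 (by simpa using (mem_ball_zero_iff.1 hz).le)]
    rfl
  rw [quadWeight, this.iteratedDeriv_eq, taylorCoeff]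

lemma continuousOn_genFun (hp : 1 ≤ p ∧ p ≤ 6) (hα : 0 < α) :
    ContinuousOn (genFun F p α) (Metric.closedBall 0 1) := by
  have h : ContinuousOn (fun z => (1 - z) ^ (α : ℂ) * regFactor F p α (1 - z))
      (Metric.closedBall 0 1) := by
    intro z hz
    have hz : ‖z‖ ≤ 1 := by simpa using hz
    have hre : 0 ≤ (1 - z).re := by
      have := (Complex.re_le_norm z).trans hz
      simp; linarith
    have h1 : ContinuousAt (fun z : ℂ => (1 - z) ^ (α : ℂ)) z :=
      ContinuousAt.comp (g := fun w : ℂ => w ^ (α : ℂ)) (f := fun z : ℂ => 1 - z)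
        (Complex.continuousAt_cpow_const_of_re_pos (Or.inl hre) (by simpa using hα)) (by fun_prop)
    have h2 : ContinuousAt (fun z => regFactor F p α (1 - z)) z :=
      ContinuousAt.comp (g := regFactor F p α) (f := fun z : ℂ => 1 - z)
        (differentiableAt_regFactor
          (bdfQuot_mem_slitPlane hp (by simpa using hz))).continuousAt (by fun_prop)
    exact (h1.mul h2).continuousWithinAt
  refine h.congr fun z hz => genFun_eq hp hα (by simpa using hz)

lemma differentiableOn_genFun (hp : 1 ≤ p ∧ p ≤ 6) (hα : 0 < α) :
    DifferentiableOn ℂ (genFun F p α) (Metric.ball 0 1) := by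
  have h : DifferentiableOn ℂ (fun z => (1 - z) ^ (α : ℂ) * regFactor F p α (1 - z))
      (Metric.ball 0 1) := by
    intro z hz
    have hz : ‖z‖ < 1 := by simpa using hz
    have hre : 0 < (1 - z).re := by
      have := (Complex.re_le_norm z).trans_lt hz
      simp; linarith
    have h1 : DifferentiableAt ℂ (fun z : ℂ => (1 - z) ^ (α : ℂ)) z :=
      DifferentiableAt.cpow_const (by fun_prop) (Or.inl hre)
    have h2 : DifferentiableAt ℂ (fun z => regFactor F p α (1 - z)) z :=
      (differentiableAt_regFactor (bdfQuot_mem_slitPlane hp (by simpa using hz.le))).comp z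
        (by fun_prop : DifferentiableAt ℂ (fun z : ℂ => 1 - z) z)
    exact (h1.mul h2).differentiableWithinAt
  refine h.congr fun z hz => genFun_eq hp hα (by simpa using (mem_ball_zero_iff.1 hz).le)

/-- The Taylor series of the generating function represents it up to the boundary of the disc. -/
lemma hasSum_quadWeight (hp : 1 ≤ p ∧ p ≤ 6) (hα : 0 < α ∧ α ≤ 1) {z : ℂ} (hz : ‖z‖ ≤ 1) :
    HasSum (fun n => quadWeight F p α n * z ^ n) (genFun F p α z) := by
  have hs := summable_norm_quadWeight (F := F) hp hα
  have hle : ∀ (n : ℕ) (z : ℂ), z ∈ Metric.closedBall (0 : ℂ) 1 →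
      ‖quadWeight F p α n * z ^ n‖ ≤ ‖quadWeight F p α n‖ := by
    intro n z hz
    rw [norm_mul, norm_pow]
    exact mul_le_of_le_one_right (norm_nonneg _)
      (pow_le_one₀ (norm_nonneg _) (by simpa using hz))
  have hcont : ContinuousOn (fun z => ∑' n, quadWeight F p α n * z ^ n)
      (Metric.closedBall (0 : ℂ) 1) :=
    continuousOn_tsum (fun n => by fun_prop) hs hle
  have heq : Set.EqOn (fun z => ∑' n, quadWeight F p α n * z ^ n) (genFun F p α)
      (Metric.ball (0 : ℂ) 1) := fun z hz =>
    (hasSum_taylorCoeff (differentiableOn_genFun hp hα.1) hz).tsum_eq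
  have heq' := heq.of_subset_closure hcont (continuousOn_genFun hp hα.1)
    Metric.ball_subset_closedBall (closure_ball (0 : ℂ) one_ne_zero).ge
  have hz' : z ∈ Metric.closedBall (0 : ℂ) 1 := by simpa using hz
  have hsum : Summable fun n => quadWeight F p α n * z ^ n :=
    Summable.of_norm_bounded hs fun n => hle n z hz'
  have h := hsum.hasSum
  have h2 := heq' hz'
  simp only at h2
  rwa [h2] at h

end

end SemiImplicit

/-! ### Order of consistency -/

namespace SemiImplicit

open Filter Topology Asymptotics

lemma sum_Icc_one_eq_sum_range (p : ℕ) (f : ℕ → ℂ) :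
    ∑ k ∈ Finset.Icc 1 p, f k = ∑ k ∈ Finset.range p, f (k + 1) := by
  induction p with
  | zero => simp
  | succ p ih => rw [Finset.sum_Icc_succ_top (by omega), ih, Finset.sum_range_succ]

lemma bdfQuot_eq_range (p : ℕ) (u : ℂ) :
    bdfQuot p u = ∑ k ∈ Finset.range p, 1 / ((k : ℂ) + 1) * u ^ k := by
  simp [bdfQuot, sum_Icc_one_eq_sum_range]

lemma gngPoly_eq_range (p : ℕ) (α : ℝ) (u : ℂ) :
    gngPoly p α u = ∑ k ∈ Finset.range p, (gngCoeff α k : ℂ) * u ^ k := by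
  simp [gngPoly, sum_Icc_one_eq_sum_range]

lemma hasDerivAt_sum_range_pow (p : ℕ) (c : ℕ → ℂ) (u : ℂ) :
    HasDerivAt (fun u => ∑ k ∈ Finset.range p, c k * u ^ k)
      (∑ k ∈ Finset.range p, c k * (k * u ^ (k - 1))) u :=
  HasDerivAt.fun_sum fun k _ => (hasDerivAt_pow k u).const_mul (c k)

/-- The coefficients of the Newton--Gregory polynomial `P` are those of the power `Q ^ α` of
`Q = ∑ u ^ k / (k + 1)`: up to order `p - 1`, `P` satisfies the differential equation
`P' Q = α P Q'` of that power. -/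
lemma gngPoly_ode {p : ℕ} (hp : 1 ≤ p ∧ p ≤ 6) (α : ℝ) :
    ∃ R : ℂ → ℂ, Continuous R ∧ ∀ u,
      (∑ k ∈ Finset.range p, (gngCoeff α k : ℂ) * (k * u ^ (k - 1))) * bdfQuot p u
        - α * gngPoly p α u * (∑ k ∈ Finset.range p, 1 / ((k : ℂ) + 1) * (k * u ^ (k - 1)))
      = u ^ (p - 1) * R u := by
  refine ⟨fun u => ∑ i ∈ Finset.range p, ∑ j ∈ Finset.range p,
    if p ≤ i + j then (i - α * j) * (gngCoeff α i / (j + 1)) * u ^ (i + j - p) else 0, ?_, ?_⟩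
  · refine continuous_finsetSum _ fun i _ => continuous_finsetSum _ fun j _ => ?_
    split_ifs <;> fun_prop
  · intro u
    simp only [bdfQuot_eq_range, gngPoly_eq_range]
    obtain ⟨h1, h6⟩ := hp
    interval_cases p <;> simp [Finset.sum_range_succ, gngCoeff] <;> ring

lemma tendsto_bdfQuot {p : ℕ} (hp : 1 ≤ p) : Tendsto (bdfQuot p) (𝓝 0) (𝓝 1) := by
  simpa [bdfQuot_zero hp] using (continuous_bdfQuot p).tendsto 0

/-- `P * Q ^ (-α) = 1 + O(u ^ p)`, because its derivative is `O(u ^ (p - 1))` by `gngPoly_ode`. -/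
lemma gngPoly_sub_isBigO {p : ℕ} (hp : 1 ≤ p ∧ p ≤ 6) (α : ℝ) :
    (fun u => gngPoly p α u - bdfQuot p u ^ (α : ℂ)) =O[𝓝 0] fun u => u ^ p := by
  obtain ⟨R, hR, hode⟩ := gngPoly_ode hp α
  set Q' : ℂ → ℂ := fun u => ∑ k ∈ Finset.range p, 1 / ((k : ℂ) + 1) * (k * u ^ (k - 1))
  set P' : ℂ → ℂ := fun u => ∑ k ∈ Finset.range p, (gngCoeff α k : ℂ) * (k * u ^ (k - 1))
  have hQd : ∀ u, HasDerivAt (bdfQuot p) (Q' u) u := fun u => by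
    rw [show bdfQuot p = _ from funext (bdfQuot_eq_range p)]
    exact hasDerivAt_sum_range_pow p _ u
  have hPd : ∀ u, HasDerivAt (gngPoly p α) (P' u) u := fun u => by
    rw [show gngPoly p α = _ from funext (gngPoly_eq_range p α)]
    exact hasDerivAt_sum_range_pow p _ u
  set f : ℂ → ℂ := fun u => gngPoly p α u * bdfQuot p u ^ (-α : ℂ)
  have hfd : ∀ u, bdfQuot p u ∈ Complex.slitPlane →
      HasDerivAt f (u ^ (p - 1) * (R u * bdfQuot p u ^ (-α - 1 : ℂ))) u := by
    intro u hu
    have h := (hPd u).mul ((hQd u).cpow_const (c := (-α : ℂ)) hu)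
    refine h.congr_deriv ?_
    have hne := Complex.slitPlane_ne_zero hu
    have e : bdfQuot p u ^ (-α : ℂ) = bdfQuot p u * bdfQuot p u ^ (-α - 1 : ℂ) := by
      rw [Complex.cpow_sub _ _ hne, Complex.cpow_one]; field_simp
    rw [e, ← mul_assoc (u ^ (p - 1)), ← hode u]
    ring
  have hslit : ∀ᶠ u in 𝓝 (0 : ℂ), bdfQuot p u ∈ Complex.slitPlane :=
    (tendsto_bdfQuot hp.1).eventually_mem
      (Complex.isOpen_slitPlane.mem_nhds Complex.one_mem_slitPlane)
  have hcont : ContinuousAt (fun u => R u * bdfQuot p u ^ (-α - 1 : ℂ)) 0 := by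
    refine hR.continuousAt.mul ((continuous_bdfQuot p).continuousAt.cpow continuousAt_const ?_)
    simp [bdfQuot_zero hp.1]
  set M : ℝ := ‖R 0 * bdfQuot p 0 ^ (-α - 1 : ℂ)‖ + 1
  have hM : ∀ᶠ u in 𝓝 (0 : ℂ), ‖R u * bdfQuot p u ^ (-α - 1 : ℂ)‖ < M :=
    hcont.norm.eventually_lt continuousAt_const (by simp [M])
  obtain ⟨ε, hε, hball⟩ := Metric.eventually_nhds_iff_ball.1 (hslit.and hM)
  have h1 : (fun u => f u - 1) =O[𝓝 0] fun u => u ^ p := by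
    refine IsBigO.of_bound M ?_
    filter_upwards [Metric.ball_mem_nhds (0 : ℂ) hε] with u hu
    have hu' : ‖u‖ < ε := by simpa using hu
    have hsub : Metric.closedBall (0 : ℂ) ‖u‖ ⊆ Metric.ball 0 ε := fun x hx => by
      have : ‖x‖ ≤ ‖u‖ := by simpa using hx
      simpa using this.trans_lt hu'
    have hb := Convex.norm_image_sub_le_of_norm_deriv_le (𝕜 := ℂ) (f := f)
      (s := Metric.closedBall (0 : ℂ) ‖u‖) (x := 0) (y := u) (C := M * ‖u‖ ^ (p - 1))
      (fun x hx => (hfd x (hball x (hsub hx)).1).differentiableAt) ?_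
      (convex_closedBall _ _) (by simp) (by simp)
    · have hf0 : f 0 = 1 := by
        have : gngPoly p α 0 = 1 := by
          obtain ⟨p, rfl⟩ : ∃ j, p = j + 1 := ⟨p - 1, by omega⟩
          rw [gngPoly_eq_range, Finset.sum_range_succ']
          simp [gngCoeff]
        simp [f, this, bdfQuot_zero hp.1]
      rw [hf0, sub_zero, mul_assoc, ← pow_succ, Nat.sub_add_cancel hp.1] at hb
      simpa using hb
    · intro x hx
      rw [(hfd x (hball x (hsub hx)).1).deriv, norm_mul, norm_pow, mul_comm]
      have hx' : ‖x‖ ≤ ‖u‖ := by simpa using hx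
      exact mul_le_mul (hball x (hsub hx)).2.le (pow_le_pow_left₀ (norm_nonneg _) hx' _)
        (by positivity) (by positivity)
  have h2 : (fun u => bdfQuot p u ^ (α : ℂ)) =O[𝓝 0] fun _ => (1 : ℂ) := by
    have : ContinuousAt (fun u => bdfQuot p u ^ (α : ℂ)) 0 :=
      (continuous_bdfQuot p).continuousAt.cpow continuousAt_const (by simp [bdfQuot_zero hp.1])
    exact this.tendsto.isBigO_one ℂ
  have h3 := h1.mul h2
  refine (h3.congr' ?_ ?_)
  · filter_upwards [hslit] with u hu
    have hne := Complex.slitPlane_ne_zero hu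
    have e : bdfQuot p u ^ (-α : ℂ) * bdfQuot p u ^ (α : ℂ) = 1 := by
      rw [← Complex.cpow_add _ _ hne]; simp
    simp only [f]
    linear_combination (gngPoly p α u) * e
  · exact Eventually.of_forall fun u => by simp

lemma regFactor_sub_isBigO (F : Family) {p : ℕ} (hp : 1 ≤ p ∧ p ≤ 6) (α : ℝ) :
    (fun u => regFactor F p α u - bdfQuot p u ^ (α : ℂ)) =O[𝓝 0] fun u => u ^ p := by
  cases F
  · simpa [regFactor] using isBigO_zero _ _
  · exact gngPoly_sub_isBigO hp α

lemma neg_log_one_sub_div_isBigO {p : ℕ} :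
    (fun u => bdfQuot p u - -Complex.log (1 - u) / u) =O[𝓝[≠] 0] fun u => u ^ p := by
  have h1 := (Complex.log_sub_logTaylor_isBigO p).comp_tendsto
    (show Tendsto (fun u : ℂ => -u) (𝓝 0) (𝓝 0) by simpa using (continuous_neg (G := ℂ)).tendsto 0)
  have h2 := (h1.mono (nhdsWithin_le_nhds (s := {(0 : ℂ)}ᶜ))).mul (isBigO_refl (fun u : ℂ => u⁻¹) _)
  refine (h2.congr' ?_ EventuallyEq.rfl).trans ?_
  · filter_upwards [self_mem_nhdsWithin] with u hu
    have hu : u ≠ 0 := hu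
    have : Complex.logTaylor (p + 1) (-u) = -bdfPoly p u := by
      rw [Complex.logTaylor, Finset.sum_range_succ', bdfPoly, sum_Icc_one_eq_sum_range,
        ← Finset.sum_neg_distrib]
      simp only [Nat.cast_zero, div_zero, add_zero]
      refine Finset.sum_congr rfl fun k _ => ?_
      have h : ((-1 : ℂ) ^ (k + 1 + 1)) * (-u) ^ (k + 1) = -u ^ (k + 1) := by
        rw [neg_pow u, ← mul_assoc, ← pow_add,
          Odd.neg_one_pow (by exact ⟨k + 1, by ring⟩)]
        ring
      rw [h]
      ring
    simp only [Function.comp_apply, this, bdfPoly_eq_mul]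
    rw [← sub_eq_add_neg]
    field_simp
    ring
  · refine IsBigO.of_bound 1 ?_
    filter_upwards [self_mem_nhdsWithin] with u hu
    have hu : u ≠ 0 := hu
    simp only [Function.comp_apply, norm_mul, norm_pow, norm_neg, norm_inv, pow_succ]
    have : ‖u‖ ≠ 0 := by simpa using hu
    field_simp
    simp

lemma tendsto_neg_log_one_sub_div :
    Tendsto (fun u : ℂ => -Complex.log (1 - u) / u) (𝓝[≠] 0) (𝓝 1) := by
  have hp0 : Tendsto (fun u : ℂ => u ^ 1) (𝓝[≠] 0) (𝓝 0) := by
    exact ((continuous_pow 1).tendsto' 0 0 (by simp)).mono_left nhdsWithin_le_nhds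
  simpa using ((tendsto_bdfQuot le_rfl).mono_left nhdsWithin_le_nhds).sub
    ((neg_log_one_sub_div_isBigO (p := 1)).trans_tendsto hp0)

/-- Order of consistency: near `u = 0` the regular factor agrees to order `p` with the one of the
exact symbol `(-log (1 - u)) ^ α`. -/
lemma regFactor_sub_log_isBigO (F : Family) {p : ℕ} (hp : 1 ≤ p ∧ p ≤ 6) (α : ℝ) :
    (fun u => regFactor F p α u - (-Complex.log (1 - u) / u) ^ (α : ℂ)) =O[𝓝[≠] 0]
      fun u => u ^ p := by
  have h1 := (regFactor_sub_isBigO F hp α).mono (nhdsWithin_le_nhds (s := {(0 : ℂ)}ᶜ))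
  have hQ := (tendsto_bdfQuot hp.1).mono_left (nhdsWithin_le_nhds (s := {(0 : ℂ)}ᶜ))
  have hB := neg_log_one_sub_div_isBigO (p := p)
  have h2 := ((Complex.hasStrictDerivAt_cpow_const (c := (α : ℂ))
    Complex.one_mem_slitPlane).hasStrictFDerivAt.isBigO_sub).comp_tendsto
      (hQ.prodMk_nhds tendsto_neg_log_one_sub_div)
  have h3 := h1.add (h2.trans hB)
  refine h3.congr_left fun u => ?_
  simp

/-- The convolution quadrature is consistent of order `p`: `ω(e ^ (-s)) = s ^ α (1 + O(s ^ p))`. -/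
lemma genFun_exp_sub_cpow (F : Family) {p : ℕ} (hp : 1 ≤ p ∧ p ≤ 6) {α : ℝ} (hα : 0 < α) :
    ∃ C r : ℝ, 0 < r ∧ ∀ s : ℂ, 0 < s.re → ‖s‖ < r →
      ‖genFun F p α (Complex.exp (-s)) - s ^ (α : ℂ)‖ ≤ C * ‖s‖ ^ (α + p) := by
  obtain ⟨C, hC0, hC⟩ := (regFactor_sub_log_isBigO F hp α).exists_nonneg
  have hC' := hC.bound
  rw [eventually_nhdsWithin_iff] at hC'
  have hre : ∀ᶠ u in 𝓝[≠] (0 : ℂ), 0 < (-Complex.log (1 - u) / u).re :=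
    (Complex.continuous_re.continuousAt.tendsto.comp
      tendsto_neg_log_one_sub_div).eventually_const_lt (by simp)
  rw [eventually_nhdsWithin_iff] at hre
  have hu : Tendsto (fun s : ℂ => 1 - Complex.exp (-s)) (𝓝 0) (𝓝 0) := by
    have : Continuous fun s : ℂ => 1 - Complex.exp (-s) := by fun_prop
    simpa using this.tendsto 0
  obtain ⟨ε, hε, hball⟩ := Metric.eventually_nhds_iff_ball.1 (hu.eventually (hC'.and hre))
  refine ⟨C * 2 ^ (α + p), min ε 1, by positivity, fun s hs hsr => ?_⟩
  obtain ⟨h1, h2⟩ := hball s (by simpa using hsr.trans_le (min_le_left _ _))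
  have hs1 : ‖s‖ < 1 := hsr.trans_le (min_le_right _ _)
  have hexp : ‖Complex.exp (-s)‖ < 1 := by rw [Complex.norm_exp]; simpa using hs
  set u := 1 - Complex.exp (-s) with hudef
  have hure : 0 < u.re := by
    have := (Complex.re_le_norm _).trans_lt hexp
    simp only [hudef, Complex.sub_re, Complex.one_re]; linarith
  have hu0 : u ≠ 0 := fun h => by rw [h] at hure; simp at hure
  specialize h1 hu0
  specialize h2 hu0
  have him : |s.im| < 1 := (Complex.abs_im_le_norm s).trans_lt hs1
  have hlog : -Complex.log (1 - u) = s := by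
    have hpi := Real.pi_gt_three
    rw [hudef, sub_sub_cancel, Complex.log_exp, neg_neg] <;> simp <;> linarith [abs_lt.1 him]
  rw [hlog] at h1 h2
  have hsplit : s ^ (α : ℂ) = u ^ (α : ℂ) * (s / u) ^ (α : ℂ) := by
    have ha1 := abs_lt.1 (Complex.abs_arg_lt_pi_div_two_iff.2 (Or.inl hure))
    have ha2 := abs_lt.1 (Complex.abs_arg_lt_pi_div_two_iff.2 (Or.inl h2))
    have hne : s / u ≠ 0 := fun h => by rw [h] at h2; simp at h2
    have hs0 : s ≠ 0 := fun h => by rw [h] at hs; simp at hs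
    have hl := (Complex.log_mul_eq_add_log_iff hu0 hne).2 ⟨by linarith, by linarith⟩
    rw [mul_div_cancel₀ _ hu0] at hl
    rw [Complex.cpow_def_of_ne_zero hs0, Complex.cpow_def_of_ne_zero hu0,
      Complex.cpow_def_of_ne_zero hne, hl, ← Complex.exp_add]
    ring_nf
  have hule : ‖u‖ ≤ 2 * ‖s‖ := by
    have := Complex.norm_exp_sub_one_le (x := -s) (by simpa using hs1.le)
    rwa [norm_sub_rev, norm_neg] at this
  rw [genFun_eq hp hα hexp.le, hsplit, ← hudef, ← mul_sub, norm_mul, Complex.norm_cpow_real]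
  have hupos : 0 < ‖u‖ := norm_pos_iff.2 hu0
  calc ‖u‖ ^ α * ‖regFactor F p α u - (s / u) ^ (α : ℂ)‖ ≤ ‖u‖ ^ α * (C * ‖u ^ p‖) := by gcongr
    _ = C * ‖u‖ ^ (α + p) := by rw [Real.rpow_add hupos, Real.rpow_natCast, norm_pow]; ring
    _ ≤ C * (2 * ‖s‖) ^ (α + p) := by gcongr
    _ = C * 2 ^ (α + p) * ‖s‖ ^ (α + p) := by
        rw [Real.mul_rpow (by norm_num) (norm_nonneg _)]; ring

end SemiImplicit

/-! ### Laplace transforms and a Tauberian theorem -/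

namespace SemiImplicit

open Filter Topology MeasureTheory

/-- The truncated power `t ↦ t_+ ^ σ`. -/
noncomputable def posPow (σ : ℝ) (t : ℝ) : ℝ := (max t 0) ^ σ

lemma posPow_nonneg (σ t : ℝ) : 0 ≤ posPow σ t := Real.rpow_nonneg (le_max_right _ _) _

lemma continuous_posPow {σ : ℝ} (hσ : 0 < σ) : Continuous (posPow σ) :=
  (continuous_id.max continuous_const).rpow_const fun _ => Or.inr hσ.le

lemma posPow_of_nonpos {σ : ℝ} (hσ : 0 < σ) {t : ℝ} (ht : t ≤ 0) : posPow σ t = 0 := by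
  rw [posPow, max_eq_right ht, Real.zero_rpow hσ.ne']

lemma posPow_mono {σ : ℝ} (hσ : 0 < σ) {s t : ℝ} (h : s ≤ t) : posPow σ s ≤ posPow σ t :=
  Real.rpow_le_rpow (le_max_right _ _) (max_le_max_right 0 h) hσ.le

lemma integrable_exp_mul_posPow {σ : ℝ} (hσ : 0 < σ) {c : ℝ} (hc : 0 < c) :
    Integrable fun t => Real.exp (-(c * t)) * posPow σ t := by
  have h := integrableOn_rpow_mul_exp_neg_mul_rpow (s := σ) (p := 1) (b := c) (by linarith)
    one_pos hc
  have h2 : (fun t => Real.exp (-(c * t)) * posPow σ t)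
      = (Set.Ioi (0 : ℝ)).indicator fun t => t ^ σ * Real.exp (-c * t ^ (1 : ℝ)) := by
    funext t
    by_cases ht : t ∈ Set.Ioi (0 : ℝ)
    · rw [Set.indicator_of_mem ht, posPow, max_eq_left (le_of_lt ht), Real.rpow_one, neg_mul,
        mul_comm]
    · rw [Set.indicator_of_notMem ht, posPow_of_nonpos hσ (not_lt.1 ht), mul_zero]
  rw [h2]
  exact h.integrable_indicator measurableSet_Ioi

lemma integral_exp_mul_posPow {σ : ℝ} (hσ : 0 < σ) {c : ℝ} (hc : 0 < c) :
    ∫ t, Real.exp (-(c * t)) * posPow σ t = Real.Gamma (σ + 1) * c ^ (-σ - 1) := by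
  have h := Real.integral_rpow_mul_exp_neg_mul_Ioi (a := σ + 1) (r := c) (by linarith) hc
  have h2 : (fun t => Real.exp (-(c * t)) * posPow σ t)
      = (Set.Ioi (0 : ℝ)).indicator fun t => t ^ (σ + 1 - 1) * Real.exp (-(c * t)) := by
    funext t
    by_cases ht : t ∈ Set.Ioi (0 : ℝ)
    · rw [Set.indicator_of_mem ht, posPow, max_eq_left (le_of_lt ht), add_sub_cancel_right,
        mul_comm]
    · rw [Set.indicator_of_notMem ht, posPow_of_nonpos hσ (not_lt.1 ht), mul_zero]
  rw [h2, integral_indicator measurableSet_Ioi, h, mul_comm, show -σ - 1 = -(σ + 1) by ring,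
    Real.rpow_neg hc.le, one_div, Real.inv_rpow hc.le]

lemma norm_cexp_neg_mul (s : ℂ) (t : ℝ) :
    ‖Complex.exp (-(s * t))‖ = Real.exp (-(s.re * t)) := by
  rw [Complex.norm_exp]; simp

lemma integrable_cexp_mul_of_continuous {s : ℂ} {g : ℝ → ℂ} (hg : Continuous g) {f : ℝ → ℝ}
    (hf : Integrable fun t => Real.exp (-(s.re * t)) * f t) (hle : ∀ t, ‖g t‖ ≤ f t) :
    Integrable fun t : ℝ => Complex.exp (-(s * t)) * g t := by
  refine hf.mono' (Continuous.aestronglyMeasurable (by fun_prop)) (ae_of_all _ fun t => ?_)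
  rw [norm_mul, norm_cexp_neg_mul]
  gcongr
  exact hle t

lemma integrable_cexp_mul_posPow {σ : ℝ} (hσ : 0 < σ) {s : ℂ} (hs : 0 < s.re) :
    Integrable fun t : ℝ => Complex.exp (-(s * t)) * (posPow σ t : ℂ) := by
  have := continuous_posPow hσ
  refine integrable_cexp_mul_of_continuous (by fun_prop) (integrable_exp_mul_posPow hσ hs)
    fun t => ?_
  simp [abs_of_nonneg (posPow_nonneg σ t)]

/-- The measure with density `t_+ ^ σ`. -/
noncomputable def posPowMeasure (σ : ℝ) : Measure ℝ :=
  volume.withDensity fun t => ((t.toNNReal ^ σ : NNReal) : ENNReal)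

lemma integrable_posPowMeasure {σ : ℝ} (hσ : 0 < σ) {c : ℝ} (hc : c < 0) :
    Integrable (fun t : ℝ => Real.exp (c * t)) (posPowMeasure σ) := by
  rw [posPowMeasure, integrable_withDensity_iff_integrable_smul (by fun_prop)]
  refine (integrable_exp_mul_posPow hσ (neg_pos.2 hc)).congr (ae_of_all _ fun t => ?_)
  simp [NNReal.smul_def, posPow, mul_comm]

lemma complexMGF_posPowMeasure (σ : ℝ) (s : ℂ) :
    ProbabilityTheory.complexMGF id (posPowMeasure σ) (-s)
      = ∫ t : ℝ, Complex.exp (-(s * t)) * (posPow σ t : ℂ) := by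
  rw [ProbabilityTheory.complexMGF, posPowMeasure,
    integral_withDensity_eq_integral_smul (by fun_prop)]
  congr 1
  funext t
  simp [NNReal.smul_def, posPow, mul_comm]

/-- The Laplace transform of `t_+ ^ σ`; the formula for real `s` extends to the half plane by the
identity theorem. -/
lemma laplace_posPow {σ : ℝ} (hσ : 0 < σ) {s : ℂ} (hs : 0 < s.re) :
    ∫ t : ℝ, Complex.exp (-(s * t)) * (posPow σ t : ℂ)
      = (Real.Gamma (σ + 1) : ℂ) * s ^ ((-σ - 1 : ℝ) : ℂ) := by
  set U : Set ℂ := {s | 0 < s.re}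
  have hU : IsOpen U := isOpen_lt continuous_const Complex.continuous_re
  have hUc : IsPreconnected U := (convex_halfSpace_re_gt 0).isPreconnected
  have hsub : Set.Iio 0 ⊆ interior (ProbabilityTheory.integrableExpSet id (posPowMeasure σ)) :=
    interior_maximal (fun c hc => integrable_posPowMeasure hσ hc) isOpen_Iio
  have h1 : AnalyticOnNhd ℂ
      (fun s => ProbabilityTheory.complexMGF id (posPowMeasure σ) (-s)) U := fun s hs =>
    (ProbabilityTheory.analyticAt_complexMGF (z := -s)
      (hsub (by simpa [U] using hs))).fun_comp analyticAt_id.neg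
  have h2 : AnalyticOnNhd ℂ
      (fun s : ℂ => (Real.Gamma (σ + 1) : ℂ) * s ^ ((-σ - 1 : ℝ) : ℂ)) U := fun s hs =>
    analyticAt_const.mul (analyticAt_id.cpow analyticAt_const (Or.inl hs))
  have hreal : ∀ c : ℝ, 0 < c → ProbabilityTheory.complexMGF id (posPowMeasure σ) (-(c : ℂ))
      = (Real.Gamma (σ + 1) : ℂ) * (c : ℂ) ^ ((-σ - 1 : ℝ) : ℂ) := by
    intro c hc
    rw [complexMGF_posPowMeasure, ← Complex.ofReal_cpow hc.le, ← Complex.ofReal_mul,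
      ← integral_exp_mul_posPow hσ hc, ← integral_complex_ofReal]
    congr 1
    funext t
    push_cast
    rfl
  have hfreq : ∃ᶠ z in 𝓝[≠] (1 : ℂ),
      ProbabilityTheory.complexMGF id (posPowMeasure σ) (-z)
        = (Real.Gamma (σ + 1) : ℂ) * z ^ ((-σ - 1 : ℝ) : ℂ) := by
    have hinj : Tendsto (fun c : ℝ => (c : ℂ)) (𝓝[≠] 1) (𝓝[≠] 1) := by
      refine tendsto_nhdsWithin_of_tendsto_nhds_of_eventually_within _ ?_ ?_
      · exact (Complex.continuous_ofReal.tendsto' 1 1 (by simp)).mono_left nhdsWithin_le_nhds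
      · filter_upwards [self_mem_nhdsWithin] with c hc
        simpa using hc
    refine hinj.frequently (Eventually.frequently ?_)
    filter_upwards [nhdsWithin_le_nhds (lt_mem_nhds (zero_lt_one (α := ℝ)))] with c hc
    exact hreal c hc
  have h := h1.eqOn_of_preconnected_of_frequently_eq h2 hUc (z₀ := 1) (by simp [U]) hfreq
  rw [← complexMGF_posPowMeasure]
  exact h hs

/-- A Tauberian theorem: a continuous function whose Laplace transform is dominated by an integrable
function on the vertical lines `re s = c`, `0 < c ≤ 1`, and extends to the imaginary axis tends to
zero. By Fourier inversion and dominated convergence it is the Fourier transform of an integrable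
function, and the Riemann--Lebesgue lemma applies. -/
theorem tendsto_zero_of_laplace {g : ℝ → ℂ} (hg : Continuous g) {G : ℂ → ℂ} {h : ℝ → ℝ}
    (hint : ∀ s : ℂ, 0 < s.re → Integrable fun t : ℝ => Complex.exp (-(s * t)) * g t)
    (hG : ∀ s : ℂ, 0 < s.re → ∫ t : ℝ, Complex.exp (-(s * t)) * g t = G s)
    (hh : Integrable h)
    (hb : ∀ c : ℝ, 0 < c → c ≤ 1 → ∀ ξ : ℝ, ξ ≠ 0 →
      ‖G (c + 2 * Real.pi * ξ * Complex.I)‖ ≤ h ξ)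
    (hlim : ∀ ξ : ℝ, ξ ≠ 0 → Tendsto (fun c : ℝ => G (c + 2 * Real.pi * ξ * Complex.I)) (𝓝[>] 0)
      (𝓝 (G (2 * Real.pi * ξ * Complex.I)))) :
    Tendsto g atTop (𝓝 0) := by
  set G₀ : ℝ → ℂ := fun ξ => G (2 * Real.pi * ξ * Complex.I)
  have hne : ∀ᵐ ξ : ℝ, ξ ≠ 0 := by simp [ae_iff]
  have hfour : ∀ c : ℝ, 0 < c → FourierTransform.fourier (fun t : ℝ => Complex.exp (-(c * t)) * g t)
      = fun ξ : ℝ => G (c + 2 * Real.pi * ξ * Complex.I) := by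
    intro c hc
    funext ξ
    rw [Real.fourier_real_eq_integral_exp_smul, ← hG _ (by simpa using hc)]
    congr 1
    funext t
    rw [smul_eq_mul, ← mul_assoc, ← Complex.exp_add]
    congr 2
    push_cast
    ring
  have hmeas : ∀ c : ℝ, 0 < c →
      AEStronglyMeasurable fun ξ : ℝ => G (c + 2 * Real.pi * ξ * Complex.I) := by
    intro c hc
    rw [← hfour c hc]
    exact (VectorFourier.fourierIntegral_continuous Real.continuous_fourierChar
      (by exact continuous_inner) (hint c (by simpa using hc))).aestronglyMeasurable
  have hinteg : ∀ c : ℝ, 0 < c → c ≤ 1 →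
      Integrable fun ξ : ℝ => G (c + 2 * Real.pi * ξ * Complex.I) := fun c hc hc1 =>
    hh.mono' (hmeas c hc) (by filter_upwards [hne] with ξ hξ using hb c hc hc1 ξ hξ)
  have hinv : ∀ c : ℝ, 0 < c → c ≤ 1 → ∀ t : ℝ,
      FourierTransformInv.fourierInv (fun ξ : ℝ => G (c + 2 * Real.pi * ξ * Complex.I)) t
        = Complex.exp (-(c * t)) * g t := by
    intro c hc hc1 t
    rw [← hfour c hc]
    refine Integrable.fourierInv_fourier_eq (hint c (by simpa using hc)) ?_
      (Continuous.continuousAt (by fun_prop))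
    rw [hfour c hc]
    exact hinteg c hc hc1
  have hkey : ∀ t : ℝ, FourierTransformInv.fourierInv G₀ t = g t := by
    intro t
    have hl1 : Tendsto (fun c : ℝ => FourierTransformInv.fourierInv
        (fun ξ : ℝ => G (c + 2 * Real.pi * ξ * Complex.I)) t) (𝓝[>] 0)
        (𝓝 (FourierTransformInv.fourierInv G₀ t)) := by
      simp only [Real.fourierInv_eq', smul_eq_mul]
      refine tendsto_integral_filter_of_dominated_convergence h ?_ ?_ hh ?_
      · filter_upwards [self_mem_nhdsWithin] with c hc
        exact (Continuous.aestronglyMeasurable (by fun_prop)).mul (hmeas c hc)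
      · filter_upwards [self_mem_nhdsWithin, nhdsWithin_le_nhds (ge_mem_nhds one_pos)] with c hc hc1
        filter_upwards [hne] with ξ hξ
        rw [norm_mul, Complex.norm_exp_ofReal_mul_I, one_mul]
        exact hb c hc hc1 ξ hξ
      · filter_upwards [hne] with ξ hξ
        exact (hlim ξ hξ).const_mul _
    have hl2 : Tendsto (fun c : ℝ => Complex.exp (-(c * t)) * g t) (𝓝[>] 0) (𝓝 (g t)) := by
      have : Continuous fun c : ℝ => Complex.exp (-(c * t)) * g t := by fun_prop
      exact (this.tendsto' 0 _ (by simp)).mono_left nhdsWithin_le_nhds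
    refine tendsto_nhds_unique hl1 (hl2.congr' ?_)
    filter_upwards [self_mem_nhdsWithin, nhdsWithin_le_nhds (ge_mem_nhds one_pos)] with c hc hc1
    exact (hinv c hc hc1 t).symm
  have hRL := (Real.zero_at_infty_fourier G₀).comp
    (tendsto_neg_atTop_atBot.mono_right atBot_le_cocompact)
  refine hRL.congr fun t => ?_
  rw [Function.comp_apply, ← Real.fourierInv_eq_fourier_neg, hkey]

end SemiImplicit

/-! ### The transform of a discrete convolution -/

namespace SemiImplicit

open Filter Topology MeasureTheory

/-- The discrete convolution of the sequence `a` with `t_+ ^ σ`, for continuous time `t`. -/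
noncomputable def shiftSum (a : ℕ → ℂ) (σ t : ℝ) : ℂ := ∑' j : ℕ, a j * (posPow σ (t - j) : ℂ)

section

variable {a : ℕ → ℂ} {σ : ℝ}

lemma norm_shiftSum_term_le (hσ : 0 < σ) (j : ℕ) {t T : ℝ} (h : t ≤ T) :
    ‖a j * (posPow σ (t - j) : ℂ)‖ ≤ ‖a j‖ * posPow σ T := by
  rw [norm_mul, Complex.norm_real, Real.norm_of_nonneg (posPow_nonneg _ _)]
  have : (0 : ℝ) ≤ j := j.cast_nonneg
  exact mul_le_mul_of_nonneg_left (posPow_mono hσ (by linarith)) (norm_nonneg _)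

lemma continuous_shiftSum (ha : Summable fun n => ‖a n‖) (hσ : 0 < σ) :
    Continuous (shiftSum a σ) := by
  have hc := continuous_posPow hσ
  rw [continuous_iff_continuousAt]
  intro t
  have h : ContinuousOn (shiftSum a σ) (Set.Iic (t + 1)) :=
    continuousOn_tsum (fun j => by fun_prop) (ha.mul_right (posPow σ (t + 1)))
      fun j s hs => norm_shiftSum_term_le hσ j hs
  exact h.continuousAt (Iic_mem_nhds (by linarith))

lemma norm_shiftSum_le (ha : Summable fun n => ‖a n‖) (hσ : 0 < σ) (t : ℝ) :
    ‖shiftSum a σ t‖ ≤ (∑' n, ‖a n‖) * posPow σ t :=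
  tsum_of_norm_bounded (ha.hasSum.mul_right _) fun j => norm_shiftSum_term_le hσ j le_rfl

lemma shiftSum_natCast (hσ : 0 < σ) (n : ℕ) :
    shiftSum a σ n = ∑ j ∈ Finset.range (n + 1), a (n - j) * powSeq σ j := by
  rw [shiftSum, tsum_eq_sum (s := Finset.range (n + 1)), ← Finset.sum_range_reflect]
  · refine Finset.sum_congr rfl fun j hj => ?_
    have hj : j ≤ n := by simpa [Nat.lt_succ_iff] using hj
    have e : n + 1 - 1 - j = n - j := by omega
    rw [e, Nat.cast_sub hj, sub_sub_cancel, powSeq, posPow, max_eq_left j.cast_nonneg]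
  · intro j hj
    have hj : n < j := by simpa [Nat.lt_succ_iff] using hj
    have : (n : ℝ) < j := by exact_mod_cast hj
    rw [posPow_of_nonpos hσ (by linarith)]
    simp

lemma integrable_cexp_mul_shiftSum (ha : Summable fun n => ‖a n‖) (hσ : 0 < σ) {s : ℂ}
    (hs : 0 < s.re) : Integrable fun t : ℝ => Complex.exp (-(s * t)) * shiftSum a σ t := by
  refine integrable_cexp_mul_of_continuous (f := fun t => (∑' n, ‖a n‖) * posPow σ t)
    (continuous_shiftSum ha hσ) ?_ (norm_shiftSum_le ha hσ)
  refine ((integrable_exp_mul_posPow hσ hs).const_mul (∑' n, ‖a n‖)).congr (ae_of_all _ fun t => ?_)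
  ring

lemma laplace_shiftSum (ha : Summable fun n => ‖a n‖) (hσ : 0 < σ) {s w : ℂ} (hs : 0 < s.re)
    (hw : HasSum (fun n => a n * Complex.exp (-s) ^ n) w) :
    ∫ t : ℝ, Complex.exp (-(s * t)) * shiftSum a σ t
      = (Real.Gamma (σ + 1) : ℂ) * s ^ ((-σ - 1 : ℝ) : ℂ) * w := by
  set F : ℕ → ℝ → ℂ := fun j t => Complex.exp (-(s * t)) * (a j * (posPow σ (t - j) : ℂ))
  have hF : ∀ j, F j = fun t : ℝ => (a j * Complex.exp (-s) ^ j) *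
      (fun t : ℝ => Complex.exp (-(s * t)) * (posPow σ t : ℂ)) (t - j) := by
    intro j
    funext t
    simp only [F]
    rw [← Complex.exp_nat_mul, show -(s * (t : ℂ)) = (j : ℂ) * -s + -(s * ((t - j : ℝ) : ℂ)) by
      push_cast; ring, Complex.exp_add]
    ring
  have hFi : ∀ j, Integrable (F j) := fun j => by
    rw [hF]
    exact ((integrable_cexp_mul_posPow hσ hs).comp_sub_right (j : ℝ)).const_mul _
  have hint : ∀ j, ∫ t, F j t
      = (Real.Gamma (σ + 1) : ℂ) * s ^ ((-σ - 1 : ℝ) : ℂ) * (a j * Complex.exp (-s) ^ j) := by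
    intro j
    rw [hF, integral_const_mul, integral_sub_right_eq_self
      (fun t : ℝ => Complex.exp (-(s * t)) * (posPow σ t : ℂ)), laplace_posPow hσ hs]
    ring
  have hnorm : ∀ j, ∫ t, ‖F j t‖ ≤
      ‖a j‖ * ∫ t : ℝ, ‖Complex.exp (-(s * t)) * (posPow σ t : ℂ)‖ := by
    intro j
    rw [hF]
    simp only [norm_mul _ (Complex.exp _ * _), norm_mul (a j)]
    rw [integral_const_mul, integral_sub_right_eq_self
      (fun t : ℝ => ‖Complex.exp (-(s * t)) * (posPow σ t : ℂ)‖)]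
    refine mul_le_mul_of_nonneg_right ?_ (integral_nonneg fun t => norm_nonneg _)
    refine mul_le_of_le_one_right (norm_nonneg _) ?_
    rw [norm_pow, Complex.norm_exp]
    exact pow_le_one₀ (Real.exp_nonneg _) (by simpa using hs.le)
  have hsum : Summable fun j => ∫ t, ‖F j t‖ :=
    Summable.of_nonneg_of_le (fun j => integral_nonneg fun t => norm_nonneg _) hnorm
      (ha.mul_right _)
  have h := hasSum_integral_of_summable_integral_norm hFi hsum
  simp only [hint] at h
  have h2 := h.unique (hw.mul_left ((Real.Gamma (σ + 1) : ℂ) * s ^ ((-σ - 1 : ℝ) : ℂ)))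
  rw [← h2]
  congr 1
  funext t
  simp only [F]
  rw [tsum_mul_left, shiftSum]

end

/-- The majorant behaves as `|ξ| ^ (e - 1)` near the origin and as `|ξ| ^ (-1 - η)` at infinity. -/
lemma integrable_near_far_majorant {e η : ℝ} (he : 0 < e) (hη : 0 < η) (C K : ℝ) :
    Integrable fun ξ : ℝ => C * ((Set.Ioc (0 : ℝ) 1).indicator (fun x => x ^ (e - 1)) ξ
      + (Set.Ioc (0 : ℝ) 1).indicator (fun x => x ^ (e - 1)) (-ξ)
      + K * (1 + ‖ξ‖) ^ (-(1 + η))) := by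
  have h1 : Integrable ((Set.Ioc (0 : ℝ) 1).indicator fun x => x ^ (e - 1)) := by
    rw [integrable_indicator_iff measurableSet_Ioc, ← intervalIntegrable_iff_integrableOn_Ioc_of_le
      zero_le_one]
    exact intervalIntegral.intervalIntegrable_rpow' (by linarith)
  have h2 : Integrable fun ξ : ℝ => (1 + ‖ξ‖) ^ (-(1 + η)) :=
    integrable_one_add_norm (by simpa using hη)
  exact ((h1.add h1.comp_neg).add (h2.const_mul K)).const_mul C

/-- The Tauberian theorem in the form used for the quadrature error: the transform `G` may have an
integrable power singularity at the origin and decays faster than `1 / ‖s‖` at infinity. -/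
lemma tendsto_zero_of_laplace_bounds {g : ℝ → ℂ} (hg : Continuous g) {G : ℂ → ℂ}
    (hint : ∀ s : ℂ, 0 < s.re → Integrable fun t : ℝ => Complex.exp (-(s * t)) * g t)
    (hG : ∀ s : ℂ, 0 < s.re → ∫ t : ℝ, Complex.exp (-(s * t)) * g t = G s)
    (hcont : ∀ s : ℂ, s.re = 0 → s.im ≠ 0 → ContinuousWithinAt G {s | 0 ≤ s.re} s)
    {r e η C : ℝ} (hr : 0 < r) (hr1 : r ≤ 1) (he : 0 < e) (he1 : e ≤ 1) (hη : 0 < η) (hC : 0 ≤ C)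
    (hnear : ∀ s : ℂ, 0 < s.re → ‖s‖ < r → ‖G s‖ ≤ C * ‖s‖ ^ (e - 1))
    (hfar : ∀ s : ℂ, 0 < s.re → r ≤ ‖s‖ → ‖G s‖ ≤ C * ‖s‖ ^ (-(1 + η))) :
    Tendsto g atTop (𝓝 0) := by
  have hf0 : ∀ x : ℝ, 0 ≤ (Set.Ioc (0 : ℝ) 1).indicator (fun x => x ^ (e - 1)) x := fun x =>
    Set.indicator_nonneg (fun x hx => Real.rpow_nonneg hx.1.le _) x
  refine tendsto_zero_of_laplace hg hint hG
    (integrable_near_far_majorant he hη C ((1 / r + 1) ^ (1 + η))) ?_ ?_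
  · intro c hc hc1 ξ hξ
    set s : ℂ := c + 2 * Real.pi * ξ * Complex.I with hs
    have hre : s.re = c := by simp [hs]
    have him : s.im = 2 * Real.pi * ξ := by simp [hs]
    have hξs : |ξ| ≤ ‖s‖ := by
      have h1 := Complex.abs_im_le_norm s
      rw [him, abs_mul, abs_of_pos (by positivity : 0 < 2 * Real.pi)] at h1
      nlinarith [Real.pi_gt_three, abs_nonneg ξ]
    have hξ0 : 0 < |ξ| := abs_pos.2 hξ
    have hs0 : 0 < ‖s‖ := hξ0.trans_le hξs
    rcases lt_or_ge ‖s‖ r with hlt | hge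
    · refine (hnear s (by rw [hre]; exact hc) hlt).trans (mul_le_mul_of_nonneg_left ?_ hC)
      have h1 : ‖s‖ ^ (e - 1) ≤ |ξ| ^ (e - 1) :=
        Real.rpow_le_rpow_of_nonpos hξ0 hξs (by linarith)
      have h2 : 0 ≤ (1 / r + 1) ^ (1 + η) * (1 + ‖ξ‖) ^ (-(1 + η)) := by positivity
      have h3 : |ξ| ≤ 1 := hξs.trans (hlt.le.trans hr1)
      rcases lt_or_gt_of_ne hξ with hneg | hpos
      · have h4 := hf0 ξ
        rw [abs_of_neg hneg] at h1 h3
        rw [Set.indicator_of_mem (show -ξ ∈ Set.Ioc (0 : ℝ) 1 from ⟨by linarith, h3⟩)]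
        linarith
      · have h4 := hf0 (-ξ)
        rw [abs_of_pos hpos] at h1 h3
        rw [Set.indicator_of_mem (show ξ ∈ Set.Ioc (0 : ℝ) 1 from ⟨by linarith, h3⟩)]
        linarith
    · refine (hfar s (by rw [hre]; exact hc) hge).trans (mul_le_mul_of_nonneg_left ?_ hC)
      have h1 := hf0 ξ
      have h2 := hf0 (-ξ)
      have h3 : 1 + ‖ξ‖ ≤ (1 / r + 1) * ‖s‖ := by
        have : 1 ≤ 1 / r * ‖s‖ := by rw [one_div, inv_mul_eq_div, le_div_iff₀ hr]; linarith
        rw [Real.norm_eq_abs]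
        linarith
      have h4 : ‖s‖ ^ (-(1 + η)) = (1 / r + 1) ^ (1 + η) * ((1 / r + 1) * ‖s‖) ^ (-(1 + η)) := by
        rw [Real.mul_rpow (by positivity) hs0.le, ← mul_assoc, ← Real.rpow_add (by positivity)]
        simp
      have h5 : ((1 / r + 1) * ‖s‖) ^ (-(1 + η)) ≤ (1 + ‖ξ‖) ^ (-(1 + η)) :=
        Real.rpow_le_rpow_of_nonpos (by positivity) h3 (by linarith)
      have h6 := mul_le_mul_of_nonneg_left h5 (by positivity : 0 ≤ (1 / r + 1) ^ (1 + η))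
      linarith
  · intro ξ hξ
    have h := hcont (2 * Real.pi * ξ * Complex.I) (by simp) (by simp [hξ, Real.pi_ne_zero])
    refine h.tendsto.comp (tendsto_nhdsWithin_of_tendsto_nhds_of_eventually_within _ ?_ ?_)
    · have : Continuous fun c : ℝ => (c : ℂ) + 2 * Real.pi * ξ * Complex.I := by fun_prop
      exact (this.tendsto' 0 _ (by simp)).mono_left nhdsWithin_le_nhds
    · filter_upwards [self_mem_nhdsWithin] with c hc
      simpa using le_of_lt hc

end SemiImplicit

/-! ### Quadrature errors for powers away from the critical exponent -/

namespace SemiImplicit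

open Filter Topology MeasureTheory

section

variable {F : Family} {p : ℕ} {α σ : ℝ}

lemma norm_cexp_neg_le_one {s : ℂ} (hs : 0 ≤ s.re) : ‖Complex.exp (-s)‖ ≤ 1 := by
  rw [Complex.norm_exp]
  simpa using hs

lemma norm_genFun_le (hp : 1 ≤ p ∧ p ≤ 6) (hα : 0 < α ∧ α ≤ 1) {z : ℂ} (hz : ‖z‖ ≤ 1) :
    ‖genFun F p α z‖ ≤ ∑' n, ‖quadWeight F p α n‖ := by
  rw [← (hasSum_quadWeight hp hα hz).tsum_eq]
  refine tsum_of_norm_bounded (summable_norm_quadWeight hp hα).hasSum fun n => ?_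
  rw [norm_mul, norm_pow]
  exact mul_le_of_le_one_right (norm_nonneg _) (pow_le_one₀ (norm_nonneg _) hz)

/-- The quadrature approximates a function `ψ` asymptotically, provided the Laplace transform `Ψ` of
`ψ` matches the one of the quadrature at the origin up to an integrable singularity. -/
lemma tendsto_shiftSum_sub (hp : 1 ≤ p ∧ p ≤ 6) (hα : 0 < α ∧ α ≤ 1) (hσ : 0 < σ)
    {ψ : ℝ → ℂ} {Ψ : ℂ → ℂ} (hψ : Continuous ψ)
    (hint : ∀ s : ℂ, 0 < s.re → Integrable fun t : ℝ => Complex.exp (-(s * t)) * ψ t)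
    (hΨ : ∀ s : ℂ, 0 < s.re → ∫ t : ℝ, Complex.exp (-(s * t)) * ψ t = Ψ s)
    (hcont : ∀ s : ℂ, s.re = 0 → s.im ≠ 0 → ContinuousAt Ψ s)
    {r e η C : ℝ} (hr : 0 < r) (hr1 : r ≤ 1) (he : 0 < e) (he1 : e ≤ 1) (hη : 0 < η) (hησ : η ≤ σ)
    (hnear : ∀ s : ℂ, 0 < s.re → ‖s‖ < r →
      ‖(Real.Gamma (σ + 1) : ℂ) * s ^ ((-σ - 1 : ℝ) : ℂ) * genFun F p α (Complex.exp (-s)) - Ψ s‖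
        ≤ C * ‖s‖ ^ (e - 1))
    (hfar : ∀ s : ℂ, 0 < s.re → r ≤ ‖s‖ → ‖Ψ s‖ ≤ C * ‖s‖ ^ (-(1 + η))) :
    Tendsto (fun t => shiftSum (quadWeight F p α) σ t - ψ t) atTop (𝓝 0) := by
  have ha := summable_norm_quadWeight (F := F) hp hα
  have hΓ : 0 < Real.Gamma (σ + 1) := Real.Gamma_pos_of_pos (by linarith)
  set A := ∑' n, ‖quadWeight F p α n‖
  have hA0 : 0 ≤ A := tsum_nonneg fun n => norm_nonneg _
  set K := Real.Gamma (σ + 1) * A * r ^ (η - σ)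
  have hK : 0 ≤ K := by positivity
  refine tendsto_zero_of_laplace_bounds ((continuous_shiftSum ha hσ).sub hψ)
    (G := fun s => (Real.Gamma (σ + 1) : ℂ) * s ^ ((-σ - 1 : ℝ) : ℂ)
      * genFun F p α (Complex.exp (-s)) - Ψ s) (r := r) (e := e) (η := η) (C := |C| + K)
    ?_ ?_ ?_ hr hr1 he he1 hη (by positivity) ?_ ?_
  · intro s hs
    simp only [mul_sub]
    exact (integrable_cexp_mul_shiftSum ha hσ hs).sub (hint s hs)
  · intro s hs
    simp only [mul_sub]
    rw [integral_sub (integrable_cexp_mul_shiftSum ha hσ hs) (hint s hs), hΨ s hs,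
      laplace_shiftSum ha hσ hs (hasSum_quadWeight hp hα (norm_cexp_neg_le_one hs.le))]
  · intro s hre him
    have h1 : ContinuousAt (fun s : ℂ => (Real.Gamma (σ + 1) : ℂ) * s ^ ((-σ - 1 : ℝ) : ℂ)) s :=
      continuousAt_const.mul (continuousAt_id.cpow continuousAt_const (Or.inr him))
    have h2 : ContinuousWithinAt (fun s => genFun F p α (Complex.exp (-s))) {s | 0 ≤ s.re} s := by
      have h3 : ContinuousOn (fun s => genFun F p α (Complex.exp (-s))) {s | 0 ≤ s.re} :=
        (continuousOn_genFun hp hα.1).comp (by fun_prop)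
          fun s hs => by simpa using norm_cexp_neg_le_one (s := s) hs
      exact h3 s (by simp [hre])
    exact (h1.continuousWithinAt.mul h2).sub (hcont s hre him).continuousWithinAt
  · intro s hs hsr
    refine (hnear s hs hsr).trans (mul_le_mul_of_nonneg_right ?_ (by positivity))
    linarith [le_abs_self C]
  · intro s hs hsr
    have hs0 : 0 < ‖s‖ := hr.trans_le hsr
    have h1 : ‖(Real.Gamma (σ + 1) : ℂ) * s ^ ((-σ - 1 : ℝ) : ℂ) * genFun F p α (Complex.exp (-s))‖
        ≤ K * ‖s‖ ^ (-(1 + η)) := by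
      rw [norm_mul, norm_mul, Complex.norm_real, Real.norm_of_nonneg hΓ.le, Complex.norm_cpow_real]
      have h2 : ‖s‖ ^ (-σ - 1) ≤ r ^ (η - σ) * ‖s‖ ^ (-(1 + η)) := by
        rw [show -σ - 1 = (η - σ) + (-(1 + η)) by ring, Real.rpow_add hs0]
        exact mul_le_mul_of_nonneg_right
          (Real.rpow_le_rpow_of_nonpos hr hsr (by linarith)) (by positivity)
      calc _ ≤ Real.Gamma (σ + 1) * (r ^ (η - σ) * ‖s‖ ^ (-(1 + η))) * A := by
            gcongr
            exact norm_genFun_le hp hα (norm_cexp_neg_le_one hs.le)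
        _ = _ := by simp only [K]; ring
    have h3 : C * ‖s‖ ^ (-(1 + η)) ≤ |C| * ‖s‖ ^ (-(1 + η)) :=
      mul_le_mul_of_nonneg_right (le_abs_self C) (by positivity)
    refine (norm_sub_le _ _).trans ?_
    rw [add_mul]
    linarith [hfar s hs hsr]

lemma norm_symbol_sub_le {s : ℂ} (hs : 0 < s.re) {C : ℝ}
    (hC : ‖genFun F p α (Complex.exp (-s)) - s ^ (α : ℂ)‖ ≤ C * ‖s‖ ^ (α + p)) :
    ‖s ^ ((-σ - 1 : ℝ) : ℂ) * genFun F p α (Complex.exp (-s)) - s ^ ((α - σ - 1 : ℝ) : ℂ)‖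
      ≤ C * ‖s‖ ^ (α + p - σ - 1) := by
  have hs0 : s ≠ 0 := fun h => by simp [h] at hs
  have hn : 0 < ‖s‖ := norm_pos_iff.2 hs0
  have e : s ^ ((α - σ - 1 : ℝ) : ℂ) = s ^ ((-σ - 1 : ℝ) : ℂ) * s ^ (α : ℂ) := by
    rw [← Complex.cpow_add _ _ hs0]
    congr 1
    push_cast
    ring
  rw [e, ← mul_sub, norm_mul, Complex.norm_cpow_real,
    show α + p - σ - 1 = (-σ - 1) + (α + p) by ring, Real.rpow_add hn]
  calc _ ≤ ‖s‖ ^ (-σ - 1) * (C * ‖s‖ ^ (α + p)) := by gcongr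
    _ = _ := by ring

lemma tendsto_quadrature_of_gt (hp : 1 ≤ p ∧ p ≤ 6) (hα : 0 < α ∧ α ≤ 1) (hασ : α < σ)
    (hσp : σ < α + p) :
    Tendsto (fun t => shiftSum (quadWeight F p α) σ t
      - ((Real.Gamma (σ + 1) / Real.Gamma (σ + 1 - α) * posPow (σ - α) t : ℝ) : ℂ))
      atTop (𝓝 0) := by
  obtain ⟨C, r, hr, hC⟩ := genFun_exp_sub_cpow F hp hα.1
  have hσ : 0 < σ := hα.1.trans hασ
  have hd : 0 < σ - α := by linarith
  have hΓ : 0 < Real.Gamma (σ + 1) := Real.Gamma_pos_of_pos (by linarith)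
  have hΓ' : 0 < Real.Gamma (σ + 1 - α) := Real.Gamma_pos_of_pos (by linarith)
  have hcont := continuous_posPow hd
  have hfun : ∀ s : ℂ, (fun t : ℝ => Complex.exp (-(s * t))
      * ((Real.Gamma (σ + 1) / Real.Gamma (σ + 1 - α) * posPow (σ - α) t : ℝ) : ℂ))
      = fun t : ℝ => ((Real.Gamma (σ + 1) / Real.Gamma (σ + 1 - α) : ℝ) : ℂ) *
        (Complex.exp (-(s * t)) * (posPow (σ - α) t : ℂ)) := fun s => by
    funext t
    push_cast
    ring
  refine tendsto_shiftSum_sub hp hα hσ (r := min r 1) (e := min (α + p - σ) 1) (η := σ - α)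
    (C := Real.Gamma (σ + 1) * (|C| + 1))
    (Ψ := fun s => (Real.Gamma (σ + 1) : ℂ) * s ^ ((α - σ - 1 : ℝ) : ℂ)) (by fun_prop)
    ?_ ?_ ?_ (by positivity) (min_le_right _ _) (lt_min (by linarith) one_pos) (min_le_right _ _) hd
    (by linarith [hα.1]) ?_ ?_
  · intro s hs
    rw [hfun]
    exact (integrable_cexp_mul_posPow hd hs).const_mul _
  · intro s hs
    rw [hfun, integral_const_mul, laplace_posPow hd hs, ← mul_assoc, ← Complex.ofReal_mul]
    congr 2
    · rw [show σ - α + 1 = σ + 1 - α by ring]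
      field_simp
    · congr 1
      ring
  · intro s hre him
    exact continuousAt_const.mul (continuousAt_id.cpow continuousAt_const (Or.inr him))
  · intro s hs hsr
    have hs0 : 0 < ‖s‖ := norm_pos_iff.2 fun h => by simp [h] at hs
    have h1 := norm_symbol_sub_le (σ := σ) hs (hC s hs (hsr.trans_le (min_le_left _ _)))
    have hs1 : ‖s‖ ≤ 1 := hsr.le.trans (min_le_right _ _)
    have h2 : ‖s‖ ^ (α + p - σ - 1) ≤ ‖s‖ ^ (min (α + p - σ) 1 - 1) :=
      Real.rpow_le_rpow_of_exponent_ge hs0 hs1 (by linarith [min_le_left (α + p - σ) 1])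
    rw [mul_assoc, ← mul_sub, norm_mul, Complex.norm_real, Real.norm_of_nonneg hΓ.le, mul_assoc]
    refine mul_le_mul_of_nonneg_left (h1.trans ?_) hΓ.le
    calc C * ‖s‖ ^ (α + p - σ - 1) ≤ (|C| + 1) * ‖s‖ ^ (α + p - σ - 1) :=
          mul_le_mul_of_nonneg_right (by linarith [le_abs_self C]) (by positivity)
      _ ≤ _ := by gcongr
  · intro s hs hsr
    rw [norm_mul, Complex.norm_real, Real.norm_of_nonneg hΓ.le, Complex.norm_cpow_real,
      show α - σ - 1 = -(1 + (σ - α)) by ring, mul_assoc]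
    refine mul_le_mul_of_nonneg_left (le_mul_of_one_le_left (by positivity) ?_) hΓ.le
    linarith [abs_nonneg C]

/-- For `σ < α` the exact derivative `n ^ (σ - α)` tends to zero by itself and need not be
subtracted. -/
lemma tendsto_quadrature_of_lt (hp : 1 ≤ p ∧ p ≤ 6) (hα : 0 < α ∧ α ≤ 1) (hσ : 0 < σ)
    (hασ : σ < α) :
    Tendsto (fun t => shiftSum (quadWeight F p α) σ t) atTop (𝓝 0) := by
  obtain ⟨C, r, hr, hC⟩ := genFun_exp_sub_cpow F hp hα.1
  have hΓ : 0 < Real.Gamma (σ + 1) := Real.Gamma_pos_of_pos (by linarith)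
  have h := tendsto_shiftSum_sub (F := F) hp hα hσ (ψ := fun _ => 0) (Ψ := fun _ => 0)
    (r := min r 1) (e := α - σ) (η := σ)
    (C := Real.Gamma (σ + 1) * (|C| + 1)) continuous_const (by simp) (by simp)
    (fun _ _ _ => continuousAt_const) (by positivity) (min_le_right _ _) (by linarith)
    (by linarith [hα.2]) hσ le_rfl ?_ ?_
  · simpa using h
  · intro s hs hsr
    have hs0 : 0 < ‖s‖ := norm_pos_iff.2 fun h => by simp [h] at hs
    have h1 := norm_symbol_sub_le (σ := σ) hs (hC s hs (hsr.trans_le (min_le_left _ _)))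
    have hs1 : ‖s‖ ≤ 1 := hsr.le.trans (min_le_right _ _)
    have h2 : ‖s‖ ^ (α + p - σ - 1) ≤ ‖s‖ ^ (α - σ - 1) :=
      Real.rpow_le_rpow_of_exponent_ge hs0 hs1 (by linarith [(p.cast_nonneg : (0 : ℝ) ≤ p)])
    have h3 : ‖s ^ ((α - σ - 1 : ℝ) : ℂ)‖ = ‖s‖ ^ (α - σ - 1) := Complex.norm_cpow_real _ _
    rw [sub_zero, mul_assoc, norm_mul, Complex.norm_real, Real.norm_of_nonneg hΓ.le, mul_assoc]
    refine mul_le_mul_of_nonneg_left ?_ hΓ.le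
    have h4 := norm_le_norm_sub_add (s ^ ((-σ - 1 : ℝ) : ℂ) * genFun F p α (Complex.exp (-s)))
      (s ^ ((α - σ - 1 : ℝ) : ℂ))
    have h5 : C * ‖s‖ ^ (α + p - σ - 1) ≤ |C| * ‖s‖ ^ (α - σ - 1) :=
      mul_le_mul (le_abs_self C) h2 (by positivity) (abs_nonneg C)
    rw [h3] at h4
    linarith
  · intro s hs hsr
    simp only [norm_zero]
    positivity

end

end SemiImplicit

/-! ### The critical exponent and the quadrature error -/

namespace SemiImplicit

open Filter Topology MeasureTheory

section

variable {F : Family} {p : ℕ} {α σ : ℝ}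

lemma cexp_mul_one_sub_eq_indicator (s : ℂ) :
    (fun t : ℝ => Complex.exp (-(s * t)) * ((1 - Real.exp (-(max t 0)) : ℝ) : ℂ))
      = (Set.Ioi (0 : ℝ)).indicator
        fun t : ℝ => Complex.exp (-s * t) - Complex.exp (-(s + 1) * t) := by
  funext t
  by_cases ht : t ∈ Set.Ioi (0 : ℝ)
  · rw [Set.indicator_of_mem ht, max_eq_left (le_of_lt ht)]
    push_cast
    rw [mul_sub, mul_one, ← Complex.exp_add]
    congr 2 <;> ring
  · rw [Set.indicator_of_notMem ht, max_eq_right (not_lt.1 ht)]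
    simp

lemma integrable_cexp_mul_one_sub {s : ℂ} (hs : 0 < s.re) :
    Integrable fun t : ℝ => Complex.exp (-(s * t)) * ((1 - Real.exp (-(max t 0)) : ℝ) : ℂ) := by
  rw [cexp_mul_one_sub_eq_indicator, integrable_indicator_iff measurableSet_Ioi]
  exact (integrableOn_exp_mul_complex_Ioi (by simpa using hs) 0).sub
    (integrableOn_exp_mul_complex_Ioi (by simp; linarith) 0)

lemma laplace_one_sub {s : ℂ} (hs : 0 < s.re) :
    ∫ t : ℝ, Complex.exp (-(s * t)) * ((1 - Real.exp (-(max t 0)) : ℝ) : ℂ)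
      = s⁻¹ - (s + 1)⁻¹ := by
  have h1 : (-s).re < 0 := by simpa using hs
  have h2 : (-(s + 1)).re < 0 := by simp; linarith
  rw [cexp_mul_one_sub_eq_indicator, integral_indicator measurableSet_Ioi,
    integral_sub (integrableOn_exp_mul_complex_Ioi h1 0) (integrableOn_exp_mul_complex_Ioi h2 0),
    integral_exp_mul_complex_Ioi h1, integral_exp_mul_complex_Ioi h2]
  have h3 : s ≠ 0 := fun h => by simp [h] at hs
  simp [neg_div_neg_eq, -neg_add_rev]

/-- For `σ = α` the exact derivative is a constant, whose Laplace transform `1 / s` decays too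
slowly; it is replaced by `1 - exp (-t)`. -/
lemma tendsto_quadrature_of_eq (hp : 1 ≤ p ∧ p ≤ 6) (hα : 0 < α ∧ α ≤ 1) :
    Tendsto (fun t => shiftSum (quadWeight F p α) α t
      - (Real.Gamma (α + 1) : ℂ) * ((1 - Real.exp (-(max t 0)) : ℝ) : ℂ)) atTop (𝓝 0) := by
  obtain ⟨C, r, hr, hC⟩ := genFun_exp_sub_cpow F hp hα.1
  have hΓ : 0 < Real.Gamma (α + 1) := Real.Gamma_pos_of_pos (by linarith [hα.1])
  have hfun : ∀ s : ℂ, (fun t : ℝ => Complex.exp (-(s * t))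
      * ((Real.Gamma (α + 1) : ℂ) * ((1 - Real.exp (-(max t 0)) : ℝ) : ℂ)))
      = fun t : ℝ => (Real.Gamma (α + 1) : ℂ) *
        (Complex.exp (-(s * t)) * ((1 - Real.exp (-(max t 0)) : ℝ) : ℂ)) := fun s => by
    funext t
    ring
  set ρ := min r 1
  have hρ : 0 < ρ := lt_min hr one_pos
  have hadd : ∀ s : ℂ, 0 < s.re → 1 ≤ ‖s + 1‖ ∧ ‖s‖ ≤ ‖s + 1‖ := by
    intro s hs
    constructor
    · have := Complex.re_le_norm (s + 1)
      simp only [Complex.add_re, Complex.one_re] at this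
      linarith
    · rw [← sq_le_sq₀ (norm_nonneg _) (norm_nonneg _), ← Complex.normSq_eq_norm_sq,
        ← Complex.normSq_eq_norm_sq, Complex.normSq_apply, Complex.normSq_apply]
      simp only [Complex.add_re, Complex.one_re, Complex.add_im, Complex.one_im]
      nlinarith
  refine tendsto_shiftSum_sub hp hα hα.1 (r := ρ) (e := 1) (η := α)
    (C := Real.Gamma (α + 1) * (|C| + 1 + ρ ^ (α - 1)))
    (Ψ := fun s => (Real.Gamma (α + 1) : ℂ) * (s⁻¹ - (s + 1)⁻¹)) (by fun_prop)
    ?_ ?_ ?_ hρ (min_le_right _ _) one_pos le_rfl hα.1 le_rfl ?_ ?_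
  · intro s hs
    rw [hfun]
    exact (integrable_cexp_mul_one_sub hs).const_mul _
  · intro s hs
    rw [hfun, integral_const_mul, laplace_one_sub hs]
  · intro s hre him
    have h1 : s ≠ 0 := fun h => by simp [h] at him
    have h2 : s + 1 ≠ 0 := fun h => by simpa [him] using congrArg Complex.im h
    exact continuousAt_const.mul ((continuousAt_inv₀ h1).sub
      (ContinuousAt.inv₀ (by fun_prop) h2))
  · intro s hs hsr
    have hs0 : 0 < ‖s‖ := norm_pos_iff.2 fun h => by simp [h] at hs
    have h1 := norm_symbol_sub_le (σ := α) hs (hC s hs (hsr.trans_le (min_le_left _ _)))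
    have hs1 : ‖s‖ ≤ 1 := hsr.le.trans (min_le_right _ _)
    have h2 : ‖s‖ ^ (α + p - α - 1) ≤ 1 := by
      refine Real.rpow_le_one hs0.le hs1 ?_
      have : (1 : ℝ) ≤ p := by exact_mod_cast hp.1
      linarith
    have h3 : s ^ ((α - α - 1 : ℝ) : ℂ) = s⁻¹ := by
      rw [sub_self, zero_sub]
      push_cast
      exact Complex.cpow_neg_one s
    rw [h3] at h1
    have h4 : ‖(s + 1)⁻¹‖ ≤ 1 := by
      rw [norm_inv]
      exact inv_le_one_of_one_le₀ (hadd s hs).1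
    have h5 : C * ‖s‖ ^ (α + p - α - 1) ≤ |C| * 1 :=
      mul_le_mul (le_abs_self C) h2 (by positivity) (abs_nonneg C)
    rw [sub_self, Real.rpow_zero, mul_one, mul_assoc, ← mul_sub, norm_mul, Complex.norm_real,
      Real.norm_of_nonneg hΓ.le, ← sub_add]
    refine mul_le_mul_of_nonneg_left ((norm_add_le _ _).trans ?_) hΓ.le
    have h6 : 0 ≤ ρ ^ (α - 1) := by positivity
    linarith
  · intro s hs hsr
    have hs0 : 0 < ‖s‖ := hρ.trans_le hsr
    have h1 : s ≠ 0 := norm_pos_iff.1 hs0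
    have h2 : s + 1 ≠ 0 := fun h => by
      have := (hadd s hs).1
      rw [h, norm_zero] at this
      linarith
    rw [norm_mul, Complex.norm_real, Real.norm_of_nonneg hΓ.le, mul_assoc]
    refine mul_le_mul_of_nonneg_left ?_ hΓ.le
    calc ‖s⁻¹ - (s + 1)⁻¹‖ = (‖s‖ * ‖s + 1‖)⁻¹ := by
          rw [inv_sub_inv h1 h2]; simp
      _ ≤ (‖s‖ * ‖s‖)⁻¹ := by gcongr; exact (hadd s hs).2
      _ = ‖s‖ ^ (α - 1) * ‖s‖ ^ (-(1 + α)) := by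
          rw [← Real.rpow_add hs0, show α - 1 + -(1 + α) = -(2 : ℕ) by push_cast; ring,
            Real.rpow_neg hs0.le, Real.rpow_natCast, pow_two]
      _ ≤ ρ ^ (α - 1) * ‖s‖ ^ (-(1 + α)) := by
          refine mul_le_mul_of_nonneg_right ?_ (by positivity)
          exact Real.rpow_le_rpow_of_nonpos hρ hsr (by linarith [hα.2])
      _ ≤ _ := by
          refine mul_le_mul_of_nonneg_right ?_ (by positivity)
          linarith [abs_nonneg C]

/-- The quadrature error for `t ^ σ` at `t = n` tends to zero if `σ < α + p`. -/
theorem tendsto_quadrature_error (hp : 1 ≤ p ∧ p ≤ 6) (hα : 0 < α ∧ α ≤ 1) (hσ : 0 < σ)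
    (hσp : σ < α + p) :
    Tendsto (fun n : ℕ =>
      ((Real.Gamma (σ + 1) / Real.Gamma (σ + 1 - α) * (n : ℝ) ^ (σ - α) : ℝ) : ℂ)
        - ∑ j ∈ Finset.range (n + 1), quadWeight F p α (n - j) * powSeq σ j) atTop (𝓝 0) := by
  simp only [← shiftSum_natCast hσ]
  have hcast : Tendsto (fun n : ℕ => (n : ℝ)) atTop atTop := tendsto_natCast_atTop_atTop
  rcases lt_trichotomy σ α with h | h | h
  · have h1 := ((tendsto_quadrature_of_lt (F := F) hp hα hσ h).comp hcast).neg
    have h2 : Tendsto (fun n : ℕ => Real.Gamma (σ + 1) / Real.Gamma (σ + 1 - α) *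
        (n : ℝ) ^ (σ - α)) atTop (𝓝 0) := by
      have := ((tendsto_rpow_neg_atTop (sub_pos.2 h)).comp hcast).const_mul
        (Real.Gamma (σ + 1) / Real.Gamma (σ + 1 - α))
      simpa using this
    have h3 := (Complex.continuous_ofReal.tendsto' (0 : ℝ) 0 (by simp)).comp h2
    refine ((h3.add h1).congr fun n => ?_).trans_eq (by simp)
    simp [sub_eq_add_neg]
  · subst h
    have h1 := ((tendsto_quadrature_of_eq (F := F) hp hα).comp hcast).neg
    have h2 : Tendsto (fun n : ℕ => (Real.Gamma (σ + 1) : ℂ) * (Real.exp (-(n : ℝ)) : ℂ)) atTop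
        (𝓝 0) := by
      have h3 := (Real.tendsto_exp_neg_atTop_nhds_zero).comp hcast
      have h4 := (Complex.continuous_ofReal.tendsto' (0 : ℝ) 0 (by simp)).comp h3
      simpa using h4.const_mul (Real.Gamma (σ + 1) : ℂ)
    refine ((h1.add h2).congr fun n => ?_).trans_eq (by simp)
    simp only [Function.comp_apply, max_eq_left (n.cast_nonneg : (0 : ℝ) ≤ n), add_sub_cancel_left,
      Real.Gamma_one, sub_self, Real.rpow_zero]
    push_cast
    ring
  · have h1 := ((tendsto_quadrature_of_gt (F := F) hp hα h hσp).comp hcast).neg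
    refine (h1.congr fun n => ?_).trans_eq (by simp)
    simp [posPow]

end

end SemiImplicit

/-! ### Decay of the correction weights -/

namespace SemiImplicit

open Filter Topology

/-- A nontrivial exponential sum with `#S` terms has fewer than `#S` real zeros: divide by one of
the exponentials and apply Rolle's theorem. -/
lemma expSum_eq_zero {ι : Type*} (S : Finset ι) (e : ι → ℝ) (he : Set.InjOn e S) :
    ∀ (c : ι → ℝ) (Z : Finset ℝ), S.card ≤ Z.card →
      (∀ t ∈ Z, ∑ i ∈ S, c i * Real.exp (e i * t) = 0) → ∀ i ∈ S, c i = 0 := by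
  classical
  induction S using Finset.induction_on with
  | empty => simp
  | insert a S ha ih =>
    intro c Z hcard hZ
    have heS : Set.InjOn e S := he.mono (by simp)
    set f : ℝ → ℝ := fun t => c a + ∑ i ∈ S, c i * Real.exp ((e i - e a) * t)
    set f' : ℝ → ℝ := fun t => ∑ i ∈ S, c i * (Real.exp ((e i - e a) * t) * (e i - e a))
    have hfd : ∀ t, HasDerivAt f (f' t) t := fun t => by
      refine HasDerivAt.const_add _ (HasDerivAt.fun_sum fun i _ => HasDerivAt.const_mul _ ?_)
      simpa using ((hasDerivAt_id t).const_mul (e i - e a)).exp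
    have hf0 : ∀ t ∈ Z, f t = 0 := by
      intro t ht
      have h := hZ t ht
      rw [Finset.sum_insert ha] at h
      have h2 : f t * Real.exp (e a * t) = 0 := by
        rw [← h, add_mul, Finset.sum_mul]
        congr 1
        refine Finset.sum_congr rfl fun i _ => ?_
        rw [mul_assoc, ← Real.exp_add]
        ring_nf
      exact (mul_eq_zero.1 h2).resolve_right (Real.exp_ne_zero _)
    have hrolle : ∀ x ∈ Z, ∀ y ∈ Z, x < y → ∃ z, z ∈ Set.Ioo x y ∧ f' z = 0 := by
      intro x hx y hy hxy
      obtain ⟨z, hz, h⟩ := exists_hasDerivAt_eq_zero hxy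
        (fun t _ => (hfd t).continuousAt.continuousWithinAt) ((hf0 x hx).trans (hf0 y hy).symm)
        (fun t _ => hfd t)
      exact ⟨z, hz, h⟩
    choose! ζ hζ hζ' using hrolle
    set T : Finset ℝ := ((Z ×ˢ Z).filter fun q => q.1 < q.2).image fun q => ζ q.1 q.2
    have hTcard : S.card ≤ T.card := by
      have h := Finset.card_le_of_interleaved (s := Z) (t := T) fun x hx y hy hxy _ =>
        ⟨ζ x y, Finset.mem_image.2 ⟨(x, y), by simp [hx, hy, hxy], rfl⟩, hζ x hx y hy hxy⟩
      rw [Finset.card_insert_of_notMem ha] at hcard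
      omega
    have hTz : ∀ t ∈ T, ∑ i ∈ S, (c i * (e i - e a)) * Real.exp (e i * t) = 0 := by
      intro t ht
      obtain ⟨⟨x, y⟩, hxy, rfl⟩ := Finset.mem_image.1 ht
      simp only [Finset.mem_filter, Finset.mem_product] at hxy
      have h := hζ' x hxy.1.1 y hxy.1.2 hxy.2
      have h2 := congrArg (· * Real.exp (e a * ζ x y)) h
      simp only [f', zero_mul, Finset.sum_mul] at h2
      rw [← h2]
      refine Finset.sum_congr rfl fun i _ => ?_
      rw [show e i * ζ x y = (e i - e a) * ζ x y + e a * ζ x y by ring, Real.exp_add]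
      ring
    have hS : ∀ i ∈ S, c i = 0 := by
      intro i hi
      have hne : e i ≠ e a := fun h => ha
        ((he (by simp [hi]) (by simp) h : i = a) ▸ hi)
      exact (mul_eq_zero.1 (ih heS _ T hTcard hTz i hi)).resolve_right (sub_ne_zero.2 hne)
    intro i hi
    rcases Finset.mem_insert.1 hi with rfl | hi
    · rw [Finset.card_insert_of_notMem ha] at hcard
      obtain ⟨t, ht⟩ := Finset.card_pos.1 (by omega : 0 < Z.card)
      have h := hf0 t ht
      simp only [f] at h
      rwa [Finset.sum_eq_zero fun j hj => by rw [hS j hj, zero_mul], add_zero] at h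
    · exact hS i hi

/-- The generalized Vandermonde matrix `j ^ σ_r`, `1 ≤ j, r ≤ m`, is regular. -/
lemma det_genVandermonde_ne_zero {m : ℕ} {σ : ℕ → ℝ} (hσ : Set.InjOn σ (Set.Icc 1 m)) :
    (Matrix.of fun (r j : Finset.Icc 1 m) => ((j : ℕ) : ℝ) ^ σ r).det ≠ 0 := by
  intro hdet
  obtain ⟨v, hv, hv0⟩ := Matrix.exists_vecMul_eq_zero_iff.2 hdet
  apply hv
  have hpos : ∀ j : Finset.Icc 1 m, (0 : ℝ) < (j : ℕ) := fun j => by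
    have := (Finset.mem_Icc.1 j.2).1
    exact_mod_cast this
  have hinj : Function.Injective fun j : Finset.Icc 1 m => Real.log ((j : ℕ) : ℝ) := by
    intro i j h
    have := Real.log_injOn_pos (Set.mem_Ioi.2 (hpos i)) (Set.mem_Ioi.2 (hpos j)) h
    exact Subtype.ext (by exact_mod_cast this)
  have h := expSum_eq_zero (Finset.univ : Finset (Finset.Icc 1 m)) (fun r => σ r)
    (fun i _ j _ h => Subtype.ext (hσ (Finset.mem_Icc.1 i.2) (Finset.mem_Icc.1 j.2) h)) v
    (Finset.univ.image fun j : Finset.Icc 1 m => Real.log ((j : ℕ) : ℝ))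
    (by rw [Finset.card_image_of_injective _ hinj]) ?_
  · funext i
    exact h i (Finset.mem_univ i)
  · intro t ht
    obtain ⟨j, -, rfl⟩ := Finset.mem_image.1 ht
    have := congrFun hv0 j
    rw [Matrix.vecMul, dotProduct] at this
    rw [Pi.zero_apply] at this
    rw [← this]
    refine Finset.sum_congr rfl fun r _ => ?_
    rw [Matrix.of_apply, Real.rpow_def_of_pos (hpos j), mul_comm (σ r)]

/-- Weights whose moments with respect to the powers `j ^ σ_r` tend to zero tend to zero. -/
lemma tendsto_weight {m : ℕ} {σ : ℕ → ℝ} (hσ : Set.InjOn σ (Set.Icc 1 m)) {w : ℕ → ℕ → ℂ}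
    (h : ∀ r ∈ Finset.Icc 1 m,
      Tendsto (fun n => ∑ j ∈ Finset.Icc 1 m, w n j * powSeq (σ r) j) atTop (𝓝 0)) :
    ∀ j ∈ Finset.Icc 1 m, Tendsto (fun n => w n j) atTop (𝓝 0) := by
  intro j hj
  set M : Matrix (Finset.Icc 1 m) (Finset.Icc 1 m) ℂ :=
    (Matrix.of fun (r j : Finset.Icc 1 m) => ((j : ℕ) : ℝ) ^ σ r).map (algebraMap ℝ ℂ)
  have hdet : IsUnit M.det := by
    rw [isUnit_iff_ne_zero]
    change ((algebraMap ℝ ℂ).mapMatrix _).det ≠ 0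
    rw [← RingHom.map_det]
    simpa using det_genVandermonde_ne_zero hσ
  have hM : ∀ n (r : Finset.Icc 1 m), (M.mulVec fun j => w n j) r
      = ∑ j ∈ Finset.Icc 1 m, w n j * powSeq (σ r) j := by
    intro n r
    rw [← Finset.sum_coe_sort, Matrix.mulVec, dotProduct]
    refine Finset.sum_congr rfl fun j _ => ?_
    simp [M, powSeq, mul_comm]
  have hw : ∀ n, w n j = ∑ r : Finset.Icc 1 m, M⁻¹ ⟨j, hj⟩ r *
      ∑ j ∈ Finset.Icc 1 m, w n j * powSeq (σ r) j := by
    intro n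
    have h1 := congrFun (congrArg (fun A => A.mulVec fun j : Finset.Icc 1 m => w n j)
      (Matrix.nonsing_inv_mul M hdet)) ⟨j, hj⟩
    rw [← Matrix.mulVec_mulVec, Matrix.one_mulVec] at h1
    rw [← h1, Matrix.mulVec, dotProduct]
    simp only [hM]
  simp only [hw]
  rw [show (0 : ℂ) = ∑ r : Finset.Icc 1 m, M⁻¹ ⟨j, hj⟩ r * 0 by simp]
  exact tendsto_finsetSum _ fun r _ => (h r r.2).const_mul _

lemma tendsto_sub_of_deriv_tendsto_zero {f f' : ℝ → ℝ}
    (hf : ∀ᶠ x in atTop, HasDerivAt f (f' x) x) (hf' : Tendsto f' atTop (𝓝 0)) :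
    Tendsto (fun x => f x - f (x - 1)) atTop (𝓝 0) := by
  rw [Metric.tendsto_atTop]
  intro ε hε
  have h1 : ∀ᶠ x in atTop, |f' x| < ε := by
    simpa using hf'.eventually (Metric.ball_mem_nhds 0 hε)
  obtain ⟨A, hA⟩ := eventually_atTop.1 (hf.and h1)
  refine ⟨A + 1, fun x hx => ?_⟩
  obtain ⟨ξ, hξ, h⟩ := exists_hasDerivAt_eq_slope f f' (by linarith : x - 1 < x)
    (fun y hy => (hA y (by linarith [hy.1])).1.continuousAt.continuousWithinAt)
    (fun y hy => (hA y (by linarith [hy.1])).1)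
  rw [sub_sub_cancel, div_one] at h
  rw [dist_zero_right, Real.norm_eq_abs, ← h]
  exact (hA ξ (by linarith [hξ.1])).2

lemma tendsto_rpow_sub_rpow {s : ℝ} (hs : s < 1) :
    Tendsto (fun x : ℝ => x ^ s - (x - 1) ^ s) atTop (𝓝 0) := by
  refine tendsto_sub_of_deriv_tendsto_zero (f := fun x => x ^ s) (f' := fun x => s * x ^ (s - 1))
    ?_ ?_
  · filter_upwards [eventually_gt_atTop 0] with x hx
    exact Real.hasDerivAt_rpow_const (Or.inl hx.ne')
  · simpa using (tendsto_rpow_neg_atTop (y := 1 - s) (by linarith)).const_mul s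

lemma tendsto_rpow_second_difference {s : ℝ} (hs : s < 2) :
    Tendsto (fun x : ℝ => x ^ s - 2 * (x - 1) ^ s + (x - 2) ^ s) atTop (𝓝 0) := by
  have h := tendsto_sub_of_deriv_tendsto_zero (f := fun x : ℝ => x ^ s - (x - 1) ^ s)
    (f' := fun x => s * (x ^ (s - 1) - (x - 1) ^ (s - 1))) ?_ ?_
  · refine h.congr fun x => ?_
    rw [show x - 1 - 1 = x - 2 by ring]
    ring
  · filter_upwards [eventually_gt_atTop 1] with x hx
    have h1 := Real.hasDerivAt_rpow_const (x := x) (p := s) (Or.inl (by linarith))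
    have h2 := (Real.hasDerivAt_rpow_const (x := x - 1) (p := s)
      (Or.inl (by linarith))).comp x ((hasDerivAt_id x).sub_const 1)
    refine (h1.sub h2).congr_deriv ?_
    ring
  · simpa using (tendsto_rpow_sub_rpow (s := s - 1) (by linarith)).const_mul s

lemma tendsto_penalty_powSeq {q : ℕ} (hq : q = 1 ∨ q = 2) {s : ℝ} (hs : s < q) :
    Tendsto (fun n => penalty q (powSeq s) n) atTop (𝓝 0) := by
  have hcast : Tendsto (fun n : ℕ => (n : ℝ)) atTop atTop := tendsto_natCast_atTop_atTop
  have hre := Complex.continuous_ofReal.tendsto' (0 : ℝ) 0 (by simp)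
  rcases hq with rfl | rfl
  · refine (hre.comp ((tendsto_rpow_sub_rpow (by simpa using hs)).comp hcast)).congr' ?_
    filter_upwards [eventually_ge_atTop 1] with n hn
    simp [penalty, powSeq, Nat.cast_sub hn]
  · refine (hre.comp ((tendsto_rpow_second_difference (by simpa using hs)).comp hcast)).congr' ?_
    filter_upwards [eventually_ge_atTop 2] with n hn
    simp [penalty, powSeq, Nat.cast_sub hn, Nat.cast_sub (show 1 ≤ n by omega)]

lemma powSeq_zero {s : ℝ} (hs : 0 < s) : powSeq s 0 = 0 := by
  simp [powSeq, hs.ne']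

lemma tendsto_startingWeight {F : Family} {p : ℕ} {α : ℝ} {N m : ℕ} {σ : ℕ → ℝ} {w : ℕ → ℕ → ℂ}
    (hp : 1 ≤ p ∧ p ≤ 6) (hα : 0 < α ∧ α ≤ 1) (hσ0 : ∀ r ∈ Set.Icc 1 m, 0 < σ r)
    (hσ : StrictMonoOn σ (Set.Icc 1 m)) (hσm : 1 ≤ m → σ m < α + p)
    (hw : IsStartingWeight F p α N m σ w) :
    ∀ j ∈ Finset.Icc 1 m, Tendsto (fun n => w n j) atTop (𝓝 0) := by
  refine tendsto_weight hσ.injOn fun r hr => ?_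
  have hr' : r ∈ Set.Icc 1 m := by simpa using hr
  have hm : 1 ≤ m := hr'.1.trans hr'.2
  have hle : σ r ≤ σ m := hσ.monotoneOn hr' ⟨hm, le_rfl⟩ hr'.2
  refine (tendsto_quadrature_error (F := F) hp hα (hσ0 r hr')
    (hle.trans_lt (hσm hm))).congr' ?_
  filter_upwards [eventually_ge_atTop N] with n hn
  rw [← hw n hn r hr]
  ring

lemma tendsto_penaltyWeight {q N m : ℕ} {σ : ℕ → ℝ} {w : ℕ → ℕ → ℂ}
    (hq : q = 1 ∨ q = 2) (hσ0 : ∀ r ∈ Set.Icc 1 m, 0 < σ r)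
    (hσ : StrictMonoOn σ (Set.Icc 1 m)) (hσm : 1 ≤ m → σ m < q)
    (hw : IsPenaltyWeight q N m σ w) :
    ∀ j ∈ Finset.Icc 1 m, Tendsto (fun n => w n j) atTop (𝓝 0) := by
  refine tendsto_weight hσ.injOn fun r hr => ?_
  have hr' : r ∈ Set.Icc 1 m := by simpa using hr
  have hm : 1 ≤ m := hr'.1.trans hr'.2
  have hle : σ r ≤ σ m := hσ.monotoneOn hr' ⟨hm, le_rfl⟩ hr'.2
  refine (tendsto_penalty_powSeq hq (hle.trans_lt (hσm hm))).congr' ?_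
  filter_upwards [eventually_ge_atTop N] with n hn
  have h := hw n hn r hr
  rw [corrPenalty, powSeq_zero (hσ0 r hr')] at h
  simpa using sub_eq_zero.1 h

end SemiImplicit

/-! ### Convolution equations and the Wiener algebra -/

namespace SemiImplicit

open Filter Topology ZeroAtInfty

lemma summable_smul_pow {A : Type*} [NormedRing A] [NormedAlgebra ℂ A] [CompleteSpace A]
    (h1 : ‖(1 : A)‖ ≤ 1) {S : A} (hS : ‖S‖ ≤ 1) {f : ℕ → ℂ} (hf : Summable fun n => ‖f n‖) :
    Summable fun n => f n • S ^ n := by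
  have hpow : ∀ n, ‖S ^ n‖ ≤ 1 := by
    intro n
    induction n with
    | zero => simpa using h1
    | succ n ih =>
      rw [pow_succ]
      exact (norm_mul_le _ _).trans (mul_le_one₀ ih (norm_nonneg _) hS)
  refine Summable.of_norm_bounded hf fun n => ?_
  rw [norm_smul]
  exact mul_le_of_le_one_right (norm_nonneg _) (hpow n)

/-- Wiener's lemma in operator form: if `‖S‖ ≤ 1` and the absolutely convergent power series
`∑ f_n z ^ n` has no zero in the closed unit disc, then `∑ f_n S ^ n` is invertible. The series is
formed in the commutative Banach algebra generated by `S`, to which Gelfand theory applies: its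
value at a character `φ` is the value of the power series at `φ S`, and `|φ S| ≤ 1`. -/
theorem isUnit_tsum_smul_pow {A : Type*} [NormedRing A] [NormedAlgebra ℂ A] [CompleteSpace A]
    (h1 : ‖(1 : A)‖ ≤ 1) {S : A} (hS : ‖S‖ ≤ 1) {f : ℕ → ℂ} (hf : Summable fun n => ‖f n‖)
    (h0 : ∀ z : ℂ, ‖z‖ ≤ 1 → ∑' n, f n * z ^ n ≠ 0) : IsUnit (∑' n, f n • S ^ n) := by
  let : NormedCommRing (Algebra.elemental ℂ S) :=
    { SubringClass.toNormedRing (Algebra.elemental ℂ S) with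
      mul_comm := mul_comm }
  let : NormedAlgebra ℂ (Algebra.elemental ℂ S) := SubalgebraClass.toNormedAlgebra _
  set s : Algebra.elemental ℂ S := ⟨S, Algebra.elemental.self_mem ℂ S⟩
  have hs : ‖s‖ ≤ 1 := hS
  have h1' : ‖(1 : Algebra.elemental ℂ S)‖ ≤ 1 := h1
  have hsum := summable_smul_pow h1' hs hf
  have hunit : IsUnit (∑' n, f n • s ^ n) := by
    by_contra hnot
    obtain ⟨φ, hφ⟩ := WeakDual.CharacterSpace.exists_apply_eq_zero hnot
    have hφs : ‖φ s‖ ≤ 1 :=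
      (spectrum.norm_le_norm_mul_of_mem (AlgHom.apply_mem_spectrum φ s)).trans
        (mul_le_one₀ hs (norm_nonneg _) h1')
    apply h0 (φ s) hφs
    rw [← hφ]
    have h := (hsum.hasSum.map φ (map_continuous φ)).tsum_eq
    rw [← h]
    refine tsum_congr fun n => ?_
    simp
  have h2 := hunit.map (Algebra.elemental ℂ S).val
  have h3 := (hsum.hasSum.map (Algebra.elemental ℂ S).val continuous_subtype_val).tsum_eq
  have h4 : (∑' n, f n • S ^ n) = (Algebra.elemental ℂ S).val (∑' n, f n • s ^ n) := by
    rw [← h3]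
    refine tsum_congr fun n => ?_
    simp [s]
  rw [h4]
  exact h2

lemma cocompact_nat : cocompact ℕ = atTop := by
  rw [cocompact_eq_cofinite, Nat.cofinite_eq_atTop]

/-- A null sequence as an element of the Banach space `c₀`. -/
def toC0 (u : ℕ → ℂ) (hu : Tendsto u atTop (𝓝 0)) : C₀(ℕ, ℂ) where
  toFun := u
  continuous_toFun := continuous_of_discreteTopology
  zero_at_infty' := by rwa [cocompact_nat]

lemma tendsto_of_C0 (u : C₀(ℕ, ℂ)) : Tendsto (fun n => u n) atTop (𝓝 0) := by
  have := u.zero_at_infty'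
  rwa [cocompact_nat] at this

lemma norm_apply_le_of_C0 (u : C₀(ℕ, ℂ)) (n : ℕ) : ‖u n‖ ≤ ‖u‖ :=
  u.toBCF.norm_coe_le_norm n

/-- The right shift of a sequence. -/
def shiftFun (u : ℕ → ℂ) : ℕ → ℂ
  | 0 => 0
  | n + 1 => u n

/-- The right shift on `c₀`. -/
noncomputable def shiftC0 : C₀(ℕ, ℂ) →L[ℂ] C₀(ℕ, ℂ) :=
  LinearMap.mkContinuous
    { toFun := fun u => toC0 (shiftFun u) ((tendsto_add_atTop_iff_nat 1).1 (tendsto_of_C0 u))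
      map_add' := fun u v => by
        ext n
        cases n <;> simp [toC0, shiftFun]
      map_smul' := fun c u => by
        ext n
        cases n <;> simp [toC0, shiftFun] }
    1 fun u => by
      rw [one_mul, ← ZeroAtInftyContinuousMap.norm_toBCF_eq_norm]
      refine (BoundedContinuousFunction.norm_le (norm_nonneg _)).2 fun n => ?_
      cases n with
      | zero => exact (norm_zero (E := ℂ)).trans_le (norm_nonneg u)
      | succ n => exact norm_apply_le_of_C0 u n

lemma shiftC0_pow_apply (k : ℕ) (u : C₀(ℕ, ℂ)) (n : ℕ) :
    (shiftC0 ^ k) u n = if k ≤ n then u (n - k) else 0 := by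
  induction k generalizing n with
  | zero => simp
  | succ k ih =>
    rw [pow_succ']
    cases n with
    | zero => simp; rfl
    | succ n =>
      have : (shiftC0 * shiftC0 ^ k) u (n + 1) = (shiftC0 ^ k) u n := rfl
      rw [this, ih]
      simp

/-- Evaluation at `n` as a continuous linear functional on `c₀`. -/
noncomputable def evalC0 (n : ℕ) : C₀(ℕ, ℂ) →L[ℂ] ℂ :=
  LinearMap.mkContinuous
    { toFun := fun u => u n
      map_add' := fun _ _ => rfl
      map_smul' := fun _ _ => rfl }
    1 fun u => by rw [one_mul]; exact norm_apply_le_of_C0 u n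

/-- Solutions of a convolution equation with a null sequence on the right hand side tend to zero, if
the symbol is in the Wiener algebra and has no zero in the closed unit disc. -/
theorem tendsto_zero_of_convolution {f : ℕ → ℂ} (hf : Summable fun n => ‖f n‖)
    (h0 : ∀ z : ℂ, ‖z‖ ≤ 1 → ∑' n, f n * z ^ n ≠ 0) {u : ℕ → ℂ}
    (hu : Tendsto (fun n => ∑ j ∈ Finset.range (n + 1), f (n - j) * u j) atTop (𝓝 0)) :
    Tendsto u atTop (𝓝 0) := by
  have hS : ‖shiftC0‖ ≤ 1 := LinearMap.mkContinuous_norm_le _ zero_le_one _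
  have h1 : ‖(1 : C₀(ℕ, ℂ) →L[ℂ] C₀(ℕ, ℂ))‖ ≤ 1 := ContinuousLinearMap.norm_id_le
  have hf0 : f 0 ≠ 0 := by
    have h := h0 0 (by simp)
    rwa [tsum_eq_single 0 (fun n hn => by simp [hn]), pow_zero, mul_one] at h
  have hsum := summable_smul_pow (A := C₀(ℕ, ℂ) →L[ℂ] C₀(ℕ, ℂ)) h1 (S := shiftC0) hS hf
  have happly : ∀ (v : C₀(ℕ, ℂ)) (n : ℕ), (∑' k, f k • shiftC0 ^ k) v n
      = ∑ j ∈ Finset.range (n + 1), f (n - j) * v j := by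
    intro v n
    have h := (hsum.hasSum.map ((evalC0 n).comp (ContinuousLinearMap.apply ℂ _ v))
      (ContinuousLinearMap.continuous _)).tsum_eq
    change _ = (∑' k, f k • shiftC0 ^ k) v n at h
    rw [← h, tsum_eq_sum (s := Finset.range (n + 1)), ← Finset.sum_range_reflect]
    · refine Finset.sum_congr rfl fun j hj => ?_
      have hj : j ≤ n := by simpa [Nat.lt_succ_iff] using hj
      change f (n + 1 - 1 - j) * (shiftC0 ^ (n + 1 - 1 - j)) v n = _
      rw [shiftC0_pow_apply, if_pos (by omega), show n + 1 - 1 - j = n - j by omega,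
        Nat.sub_sub_self hj]
    · intro k hk
      have hk : ¬ k ≤ n := by simpa [Nat.lt_succ_iff] using hk
      change f k * (shiftC0 ^ k) v n = 0
      rw [shiftC0_pow_apply, if_neg hk, mul_zero]
  obtain ⟨T, hT⟩ := isUnit_tsum_smul_pow (A := C₀(ℕ, ℂ) →L[ℂ] C₀(ℕ, ℂ)) h1
    (S := shiftC0) hS hf h0
  set v : C₀(ℕ, ℂ) := (↑T⁻¹ : C₀(ℕ, ℂ) →L[ℂ] C₀(ℕ, ℂ)) (toC0 _ hu)
  have hv : ∀ n, ∑ j ∈ Finset.range (n + 1), f (n - j) * v j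
      = ∑ j ∈ Finset.range (n + 1), f (n - j) * u j := by
    intro n
    rw [← happly, ← hT]
    have : (T : C₀(ℕ, ℂ) →L[ℂ] C₀(ℕ, ℂ)) v = toC0 _ hu := by
      change ((T : C₀(ℕ, ℂ) →L[ℂ] C₀(ℕ, ℂ)) * ↑T⁻¹) (toC0 _ hu) = _
      rw [Units.mul_inv]
      rfl
    rw [this]
    rfl
  have huv : ∀ n, v n = u n := by
    intro n
    induction n using Nat.strong_induction_on with
    | _ n ih =>
      have h := hv n
      rw [Finset.sum_range_succ, Finset.sum_range_succ, Nat.sub_self,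
        Finset.sum_congr rfl fun j hj => by rw [ih j (Finset.mem_range.1 hj)]] at h
      exact mul_left_cancel₀ hf0 (add_left_cancel h)
  exact (tendsto_of_C0 v).congr huv

end SemiImplicit

/-! ### The scheme as a convolution equation -/

namespace SemiImplicit

open Filter Topology

/-- The sequence defined by a recursion `U n = Φ n U`, `n ≥ N`, in which `Φ n` depends on
`U 0, …, U (n - 1)`, and starting values `v`. -/
noncomputable def recSol (N : ℕ) (Φ : ℕ → (ℕ → ℂ) → ℂ) (v : Fin N → ℂ) (n : ℕ) : ℂ :=
  if h : n < N then v ⟨n, h⟩ else Φ n fun j => if _ : j < n then recSol N Φ v j else 0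
termination_by n

lemma existsUnique_rec {N : ℕ} {Φ : ℕ → (ℕ → ℂ) → ℂ}
    (hΦ : ∀ n ≥ N, ∀ U V : ℕ → ℂ, (∀ j < n, U j = V j) → Φ n U = Φ n V) (v : Fin N → ℂ) :
    ∃! U : ℕ → ℂ, (∀ n ≥ N, U n = Φ n U) ∧ ∀ k : Fin N, U k = v k := by
  refine ⟨recSol N Φ v, ⟨fun n hn => ?_, fun k => ?_⟩, fun U hU => ?_⟩
  · rw [recSol, dif_neg (not_lt.2 hn)]
    exact hΦ n hn _ _ fun j hj => by simp [hj]
  · rw [recSol, dif_pos k.2]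
  · funext n
    induction n using Nat.strong_induction_on with
    | _ n ih =>
      rw [recSol]
      split_ifs with h
      · exact hU.2 ⟨n, h⟩
      · rw [hU.1 n (not_lt.1 h)]
        exact hΦ n (not_lt.1 h) _ _ fun j hj => by simp [hj, ih j hj]

/-- The coefficients of `(1 - z) ^ q`. -/
def penaltyCoeff (q k : ℕ) : ℂ := (-1) ^ k * (q.choose k : ℂ)

lemma penaltyCoeff_of_lt {q k : ℕ} (h : q < k) : penaltyCoeff q k = 0 := by
  simp [penaltyCoeff, Nat.choose_eq_zero_of_lt h]

lemma penalty_eq_convolution {q : ℕ} (hq : q = 1 ∨ q = 2) (u : ℕ → ℂ) {n : ℕ} (hn : q ≤ n) :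
    penalty q u n = ∑ j ∈ Finset.range (n + 1), penaltyCoeff q (n - j) * u j := by
  rw [← Finset.sum_range_reflect]
  have h : ∀ k ∈ Finset.range (n + 1), penaltyCoeff q (n - (n + 1 - 1 - k)) * u (n + 1 - 1 - k)
      = penaltyCoeff q k * u (n - k) := fun k hk => by
    have hk : k ≤ n := by simpa [Nat.lt_succ_iff] using hk
    rw [Nat.add_sub_cancel, Nat.sub_sub_self hk]
  rw [Finset.sum_congr rfl h, ← Finset.sum_subset (Finset.range_mono (by omega : q + 1 ≤ n + 1))
    fun k _ hk => by
      rw [penaltyCoeff_of_lt (by simpa [Nat.lt_succ_iff] using hk), zero_mul]]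
  rcases hq with rfl | rfl
  · simp [penalty, Finset.sum_range_succ, penaltyCoeff]
    ring
  · simp [penalty, Finset.sum_range_succ, penaltyCoeff]
    ring

lemma hasSum_penaltyCoeff {q : ℕ} (hq : q = 1 ∨ q = 2) (z : ℂ) :
    HasSum (fun n => penaltyCoeff q n * z ^ n) ((1 - z) ^ q) := by
  have h : HasSum (fun n => penaltyCoeff q n * z ^ n)
      (∑ n ∈ Finset.range (q + 1), penaltyCoeff q n * z ^ n) :=
    hasSum_sum_of_ne_finset_zero fun k hk => by
      rw [penaltyCoeff_of_lt (by simpa [Nat.lt_succ_iff] using hk), zero_mul]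
  convert h using 1
  rcases hq with rfl | rfl
  · simp [Finset.sum_range_succ, penaltyCoeff]
    ring
  · simp [Finset.sum_range_succ, penaltyCoeff]
    ring

/-- The coefficients of the symbol `ω(z) - τ^α ((λ + ρ) - (ρ + κ) (1 - z)^q)` of the scheme. -/
noncomputable def symbolCoeff (F : Family) (p q : ℕ) (α τ : ℝ) (lam rho kap : ℂ) (n : ℕ) : ℂ :=
  quadWeight F p α n
    - ((τ ^ α : ℝ) : ℂ) * ((if n = 0 then lam + rho else 0) - (rho + kap) * penaltyCoeff q n)

/-- The contribution of the starting values to step `n` of the scheme. -/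
noncomputable def startTerm (F : Family) (p : ℕ) (α τ : ℝ) (rho kap : ℂ) (m mu mf : ℕ)
    (w wu wf : ℕ → ℕ → ℂ) (U : ℕ → ℂ) (n : ℕ) : ℂ :=
  U 0 * ∑ k ∈ Finset.range (n + 1), quadWeight F p α k
    - ∑ j ∈ Finset.Icc 1 m, w n j * (U j - U 0)
    + ((τ ^ α : ℝ) : ℂ) * (rho * ∑ j ∈ Finset.Icc 1 mf, wf n j * (U j - U 0)
      + kap * ∑ j ∈ Finset.Icc 1 mu, wu n j * (U j - U 0))

section

variable {F : Family} {p q : ℕ} {α τ : ℝ} {lam rho kap : ℂ} {m mu mf : ℕ} {w wu wf : ℕ → ℕ → ℂ}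

lemma corrPenalty_const_mul {q m : ℕ} (hq : q = 1 ∨ q = 2) (w : ℕ → ℕ → ℂ) (c : ℂ) (U : ℕ → ℂ)
    (n : ℕ) : corrPenalty q m w (fun j => c * U j) n = c * corrPenalty q m w U n := by
  have h : penalty q (fun j => c * U j) n = c * penalty q U n := by
    rcases hq with rfl | rfl <;> simp only [penalty] <;> ring
  rw [corrPenalty, corrPenalty, h, mul_sub, Finset.mul_sum]
  congr 1
  refine Finset.sum_congr rfl fun j _ => ?_
  ring

/-- The scheme as a discrete convolution equation. -/
lemma scheme_step_iff (hq : q = 1 ∨ q = 2) (hτ : 0 < τ) (U : ℕ → ℂ) {n : ℕ} (hn : q ≤ n) :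
    fracDiff F p α τ m w U n = lam * U n + rho * U n - corrPenalty q mf wf (fun j => rho * U j) n
        - kap * corrPenalty q mu wu U n ↔
      ∑ j ∈ Finset.range (n + 1), symbolCoeff F p q α τ lam rho kap (n - j) * U j
        = startTerm F p α τ rho kap m mu mf w wu wf U n := by
  have hT : ((τ ^ α : ℝ) : ℂ) ≠ 0 := by exact_mod_cast (Real.rpow_pos_of_pos hτ α).ne'
  have h1 : ∑ j ∈ Finset.range (n + 1), quadWeight F p α (n - j) * (U j - U 0)
      = ∑ j ∈ Finset.range (n + 1), quadWeight F p α (n - j) * U j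
        - U 0 * ∑ k ∈ Finset.range (n + 1), quadWeight F p α k := by
    rw [← Finset.sum_range_reflect (fun k => quadWeight F p α k), Finset.mul_sum,
      ← Finset.sum_sub_distrib]
    refine Finset.sum_congr rfl fun j _ => ?_
    rw [Nat.add_sub_cancel]
    ring
  have h2 : ∑ j ∈ Finset.range (n + 1), symbolCoeff F p q α τ lam rho kap (n - j) * U j
      = ∑ j ∈ Finset.range (n + 1), quadWeight F p α (n - j) * U j
        - ((τ ^ α : ℝ) : ℂ) * ((lam + rho) * U n - (rho + kap) * penalty q U n) := by
    have h3 : (lam + rho) * U n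
        = ∑ j ∈ Finset.range (n + 1), (if n - j = 0 then lam + rho else 0) * U j := by
      rw [Finset.sum_range_succ, Finset.sum_eq_zero fun j hj => ?_]
      · simp
      · have := Finset.mem_range.1 hj
        rw [if_neg (by omega), zero_mul]
    rw [penalty_eq_convolution hq U hn, h3, Finset.mul_sum, ← Finset.sum_sub_distrib,
      Finset.mul_sum, ← Finset.sum_sub_distrib]
    refine Finset.sum_congr rfl fun j _ => ?_
    simp only [symbolCoeff]
    ring
  rw [fracDiff, h1, h2, corrPenalty_const_mul hq, corrPenalty, corrPenalty, startTerm]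
  constructor
  · intro h
    field_simp at h
    linear_combination h
  · intro h
    field_simp
    linear_combination h

lemma startTerm_congr {U V : ℕ → ℂ} {n : ℕ} (hn : firstStep q m mu mf ≤ n)
    (h : ∀ j < n, U j = V j) :
    startTerm F p α τ rho kap m mu mf w wu wf U n
      = startTerm F p α τ rho kap m mu mf w wu wf V n := by
  unfold firstStep at hn
  have hN : max m (max mu mf) < n := by omega
  have hsum : ∀ (k : ℕ) (c : ℕ → ℕ → ℂ), k ≤ max m (max mu mf) →
      ∑ j ∈ Finset.Icc 1 k, c n j * (U j - U 0) = ∑ j ∈ Finset.Icc 1 k, c n j * (V j - V 0) := by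
    intro k c hk
    refine Finset.sum_congr rfl fun j hj => ?_
    have hj := (Finset.mem_Icc.1 hj).2
    rw [h j (by omega), h 0 (by omega)]
  rw [startTerm, startTerm, hsum m w (by omega), hsum mu wu (by omega), hsum mf wf (by omega),
    h 0 (by omega)]

lemma summable_symbolCoeff (hp : 1 ≤ p ∧ p ≤ 6) (hα : 0 < α ∧ α ≤ 1) :
    Summable fun n => ‖symbolCoeff F p q α τ lam rho kap n‖ := by
  have h : Summable fun n => ‖((τ ^ α : ℝ) : ℂ) *
      ((if n = 0 then lam + rho else 0) - (rho + kap) * penaltyCoeff q n)‖ := by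
    refine summable_of_ne_finset_zero (s := Finset.range (q + 1)) fun k hk => ?_
    have hk : q < k := by simpa [Nat.lt_succ_iff] using hk
    rw [penaltyCoeff_of_lt hk, if_neg (by omega)]
    simp
  exact Summable.of_nonneg_of_le (fun _ => norm_nonneg _) (fun n => norm_sub_le _ _)
    ((summable_norm_quadWeight hp hα).add h)

lemma tsum_symbolCoeff (hp : 1 ≤ p ∧ p ≤ 6) (hα : 0 < α ∧ α ≤ 1) (hq : q = 1 ∨ q = 2) {z : ℂ}
    (hz : ‖z‖ ≤ 1) :
    ∑' n, symbolCoeff F p q α τ lam rho kap n * z ^ n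
      = genFun F p α z - ((τ ^ α : ℝ) : ℂ) * ((lam + rho) - (rho + kap) * (1 - z) ^ q) := by
  have h1 : HasSum (fun n => (if n = 0 then lam + rho else 0) * z ^ n) (lam + rho) := by
    have := hasSum_single (f := fun n => (if n = 0 then lam + rho else 0) * z ^ n) 0
      fun n hn => by simp [hn]
    simpa using this
  have h2 := (hasSum_quadWeight (F := F) hp hα hz).sub
    ((h1.sub ((hasSum_penaltyCoeff hq z).mul_left (rho + kap))).mul_left ((τ ^ α : ℝ) : ℂ))
  rw [← h2.tsum_eq]
  refine tsum_congr fun n => ?_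
  rw [symbolCoeff]
  ring

/-- The stability region is made such that the symbol of the scheme has no zero in the closed unit
disc. Where the denominator in the definition of the region vanishes the symbol is `ω(z)`, whose
only zero is `z = 1`, and there the denominator is `λ + ρ ≠ 0`. -/
lemma tsum_symbolCoeff_ne_zero (hp : 1 ≤ p ∧ p ≤ 6) (hα : 0 < α ∧ α ≤ 1) (hq : q = 1 ∨ q = 2)
    (hne : lam + rho ≠ 0) (hτ : 0 < τ) (hS : (τ : ℂ) ∈ stabilityRegion F p q α lam rho kap)
    {z : ℂ} (hz : ‖z‖ ≤ 1) : ∑' n, symbolCoeff F p q α τ lam rho kap n * z ^ n ≠ 0 := by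
  rw [tsum_symbolCoeff hp hα hq hz]
  intro h
  by_cases hD : (lam + rho) - (rho + kap) * (1 - z) ^ q = 0
  · rw [hD, mul_zero, sub_zero] at h
    by_cases hz1 : z = 1
    · have hq0 : q ≠ 0 := by omega
      apply hne
      simpa [hz1, hq0] using hD
    · exact genFun_ne_zero hp hα hz hz1 h
  · apply hS
    refine ⟨z, hz, ?_⟩
    rw [← Complex.ofReal_cpow hτ.le, eq_div_iff hD]
    exact (sub_eq_zero.1 h).symm

lemma tendsto_startTerm (hp : 1 ≤ p ∧ p ≤ 6) (hα : 0 < α ∧ α ≤ 1)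
    (hw : ∀ j ∈ Finset.Icc 1 m, Tendsto (fun n => w n j) atTop (𝓝 0))
    (hwu : ∀ j ∈ Finset.Icc 1 mu, Tendsto (fun n => wu n j) atTop (𝓝 0))
    (hwf : ∀ j ∈ Finset.Icc 1 mf, Tendsto (fun n => wf n j) atTop (𝓝 0)) (U : ℕ → ℂ) :
    Tendsto (startTerm F p α τ rho kap m mu mf w wu wf U) atTop (𝓝 0) := by
  have h1 : Tendsto (fun n => ∑ k ∈ Finset.range (n + 1), quadWeight F p α k) atTop (𝓝 0) := by
    have h := (hasSum_quadWeight (F := F) hp hα (z := 1) (by simp)).tendsto_sum_nat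
    simp only [one_pow, mul_one] at h
    rw [genFun_one hp hα.1] at h
    exact h.comp (tendsto_add_atTop_nat 1)
  have h2 : ∀ (k : ℕ) (c : ℕ → ℕ → ℂ),
      (∀ j ∈ Finset.Icc 1 k, Tendsto (fun n => c n j) atTop (𝓝 0)) →
      Tendsto (fun n => ∑ j ∈ Finset.Icc 1 k, c n j * (U j - U 0)) atTop (𝓝 0) := by
    intro k c hc
    rw [show (0 : ℂ) = ∑ j ∈ Finset.Icc 1 k, 0 * (U j - U 0) by simp]
    exact tendsto_finsetSum _ fun j hj => (hc j hj).mul_const _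
  have h3 := ((h1.const_mul (U 0)).sub (h2 m w hw)).add
    ((((h2 mf wf hwf).const_mul rho).add ((h2 mu wu hwu).const_mul kap)).const_mul
      ((τ ^ α : ℝ) : ℂ))
  exact (h3.congr fun n => rfl).trans_eq (by simp)

end

end SemiImplicit

open SemiImplicit in
theorem theorem2p2 (F : Family) (p q : ℕ) (hp : 1 ≤ p ∧ p ≤ 6) (hq : q = 1 ∨ q = 2)
    (α : ℝ) (hα : 0 < α ∧ α ≤ 1) (lam rho kap : ℂ) (hne : lam + rho ≠ 0)
    (m mu mf : ℕ) (σ δ : ℕ → ℝ)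
    (hσ_pos : ∀ r ∈ Set.Icc 1 (max m mu), 0 < σ r) (hσ_mono : StrictMonoOn σ (Set.Icc 1 (max m mu)))
    (hδ_pos : ∀ r ∈ Set.Icc 1 mf, 0 < δ r) (hδ_mono : StrictMonoOn δ (Set.Icc 1 mf))
    (hσm : 1 ≤ m → σ m < α + p) (hσmu : 1 ≤ mu → σ mu < q) (hδmf : 1 ≤ mf → δ mf < q)
    (w wu wf : ℕ → ℕ → ℂ)
    (hw : IsStartingWeight F p α (firstStep q m mu mf) m σ w)
    (hwu : IsPenaltyWeight q (firstStep q m mu mf) mu σ wu)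
    (hwf : IsPenaltyWeight q (firstStep q m mu mf) mf δ wf)
    (τ : ℝ) (hτ : 0 < τ) (hS : (τ : ℂ) ∈ stabilityRegion F p q α lam rho kap) :
    IsStable (firstStep q m mu mf)
      (IsSchemeSolution F p q α τ lam kap (fun u _ => rho * u) m mu mf w wu wf) := by
  set N := firstStep q m mu mf
  set f := symbolCoeff F p q α τ lam rho kap
  set g := startTerm F p α τ rho kap m mu mf w wu wf
  have hqN : q ≤ N := le_max_left _ _
  have hsm : Set.Icc 1 m ⊆ Set.Icc 1 (max m mu) := Set.Icc_subset_Icc_right (le_max_left _ _)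
  have hsu : Set.Icc 1 mu ⊆ Set.Icc 1 (max m mu) := Set.Icc_subset_Icc_right (le_max_right _ _)
  have hw0 := tendsto_startingWeight hp hα (fun r hr => hσ_pos r (hsm hr)) (hσ_mono.mono hsm)
    hσm hw
  have hwu0 := tendsto_penaltyWeight hq (fun r hr => hσ_pos r (hsu hr)) (hσ_mono.mono hsu)
    hσmu hwu
  have hwf0 := tendsto_penaltyWeight hq hδ_pos hδ_mono hδmf hwf
  have hsymb := fun z hz => tsum_symbolCoeff_ne_zero (z := z) hp hα hq hne hτ hS hz
  have hf0 : f 0 ≠ 0 := by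
    have h := hsymb 0 (by simp)
    rwa [tsum_eq_single 0 (fun n hn => by simp [hn]), pow_zero, mul_one] at h
  have hsol : ∀ U : ℕ → ℂ,
      IsSchemeSolution F p q α τ lam kap (fun u _ => rho * u) m mu mf w wu wf U ↔
        ∀ n ≥ N, ∑ j ∈ Finset.range (n + 1), f (n - j) * U j = g U n := fun U =>
    forall₂_congr fun n hn => scheme_step_iff hq hτ U (hqN.trans hn)
  refine fun v => ⟨?_, fun U hU _ => ?_⟩
  · have hrec := existsUnique_rec (N := N)
      (Φ := fun n U => (g U n - ∑ j ∈ Finset.range n, f (n - j) * U j) / f 0)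
      (fun n hn U V h => by
        have h1 : g U n = g V n := startTerm_congr hn h
        have h2 : ∑ j ∈ Finset.range n, f (n - j) * U j = ∑ j ∈ Finset.range n, f (n - j) * V j :=
          Finset.sum_congr rfl fun j hj => by rw [h j (Finset.mem_range.1 hj)]
        simp only [h1, h2]) v
    have hiff : ∀ U : ℕ → ℂ,
        IsSchemeSolution F p q α τ lam kap (fun u _ => rho * u) m mu mf w wu wf U ↔
          ∀ n ≥ N, U n = (g U n - ∑ j ∈ Finset.range n, f (n - j) * U j) / f 0 := fun U => by
      rw [hsol]
      refine forall₂_congr fun n _ => ?_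
      rw [Finset.sum_range_succ, Nat.sub_self, eq_div_iff hf0, eq_sub_iff_add_eq, add_comm,
        mul_comm]
    simpa only [hiff] using hrec
  · refine tendsto_zero_of_convolution (summable_symbolCoeff hp hα) hsymb ?_
    refine (tendsto_startTerm (F := F) (τ := τ) (rho := rho) (kap := kap) hp hα hw0 hwu0 hwf0
      U).congr' ?_
    filter_upwards [Filter.eventually_ge_atTop N] with n hn
    exact ((hsol U).1 hU n hn).symm
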